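/- Let $d\ge 2$, write $\lambda_k$ for $k$-dimensional Hausdorff measure on $\mathbb R^d$ (normalized to agree with Lebesgue measure on $k$-dimensional subspaces) and $\omega_k$ for the volume of the Euclidean unit ball of $\mathbb R^k$. A convex body is a compact convex subset of $\mathbb R^d$ with nonempty interior, and the polar of a nonempty set $S$ is $S^\circ=\{y\in\mathbb R^d:\langle x,y\rangle\le 1\ \text{for all }x\in S\}$. For a linear subspace $T$ and a nonempty $S\subseteq T$, put $S^{\circ}_T=\{y\in T:\langle x,y\rangle\le 1\ \text{for all }x\in S\}$. For a convex body $K$ and $x\in\operatorname{int}(K)$, the Funk Finsler ball at $x$ is $B_K(x)=\{v:\|v\|_{K-x}\le 1\}=K-x$, where $\|v\|_{K-x}=\inf\{\lambda>0: v\in\lambda(K-x)\}$. For a convex body $G\subset\operatorname{int}(K)$, the Funk Holmes–Thompson volume of $G$ and the Funk Holmes–Thompson area of $\partial G$ in the geometry of $K$ are $$\mathrm{vol}^F_K(G)=\frac1{\omega_d}\int_G\lambda_d\big(B_K(x)^\circ\big)\,d\lambda_d(x),\qquad \mathrm{area}^F_K(G)=\frac1{\omega_{d-1}}\int_{\partial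 G}\lambda_{d-1}\big((B_K(x)\cap T_x)^\circ_{T_x}\big)\,d\lambda_{d-1}(x),$$ where the second integral is over the smooth points $x$ of $\partial G$ (those with a unique outer unit normal, which form a set of full $\lambda_{d-1}$-measure in $\partial G$), and $T_x$ is the linear hyperplane orthogonal to the outer unit normal of $G$ at $x$. Lemma (Duality of Funk Holmes–Thompson measures). Let $G$ and $K$ be convex bodies in $\mathbb R^d$ with $O\in\operatorname{int}(G)$ and $G\subset\operatorname{int}(K)$. Then (i) $\mathrm{vol}^F_K(G)=\mathrm{vol}^F_{G^\circ}(K^\circ)$, and (ii) $\mathrm{area}^F_K(G)=\mathrm{area}^F_{G^\circ}(K^\circ)$. -/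

import Mathlib

/-!
Translating the polar about a point `x` of `G` is the projective map `z ↦ z / (1 - ⟪x, z⟫)`, whose
Jacobian is `(1 - ⟪x, z⟫)⁻⁽ᵈ⁺¹⁾`. Hence `ω_d vol_K(G)` is the integral of `(1 - ⟪x, z⟫)⁻⁽ᵈ⁺¹⁾` over
`(x, z) ∈ G × K°`, an expression which is symmetric under `(G, K) ↦ (K°, G°)`.

For the area, let `h` and `g` be the support functions of `K` and `G°`, so that `∂G = {g = 1}` and
the outer normal of `G` at `x` is parallel to `∇g(x)`. The polar of a central section of `K - x` is
a shadow of `(K - x)°`, so the area density at `x` is, by Cauchy's projection formula, an integral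
of `|⟪∇h(θ) - x, ∇g(x)⟫| / ‖∇g(x)‖` against `(h(θ) - ⟪x, θ⟫)⁻ᵈ dθ` over unit vectors `θ`, where
`⟪x, ∇g(x)⟫ = 1` by Euler's identity. The factor `‖∇g(x)‖⁻¹` turns surface measure on `∂G` into the
cone measure, which in polar coordinates `x = φ / g(φ)` is `g(φ)⁻ᵈ dφ`. Altogether
`2 ω_{d-1} area_K(G)` is the double integral over unit vectors `φ, θ` of
`|⟪∇h(θ), ∇g(φ)⟫ - 1| (g(φ) h(θ) - ⟪φ, θ⟫)⁻ᵈ`, again a symmetric expression.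

The boundary is only Lipschitz, so surface and cone measure are compared without an area formula:
on a piece of `∂G` on which `∇g` is nearly constant, projection from the origin to a tangent
hyperplane distorts both measures by a factor close to one.
-/

open MeasureTheory Set
open scoped ENNReal RealInnerProductSpace Pointwise

noncomputable section

namespace HolmesThompson

/-- Euclidean space `ℝ^d` with its standard inner product. -/
abbrev E (d : ℕ) : Type := EuclideanSpace ℝ (Fin d)

/-- A convex body: a compact convex set with nonempty interior. -/
structure IsConvexBody {d : ℕ} (K : Set (E d)) : Prop where
  isCompact : IsCompact K
  convex : Convex ℝ K
  nonempty_interior : (interior K).Nonempty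

/-- The polar of `S` inside the linear subspace `T`:
`{y ∈ T : ⟪x, y⟫ ≤ 1 for all x ∈ S}`. -/
def polarIn {d : ℕ} (T : Submodule ℝ (E d)) (S : Set (E d)) : Set (E d) :=
  {y | y ∈ T ∧ ∀ x ∈ S, ⟪x, y⟫ ≤ 1}

/-- The polar `S° = {y : ⟪x, y⟫ ≤ 1 for all x ∈ S}`. -/
def polarBody {d : ℕ} (S : Set (E d)) : Set (E d) :=
  {y | ∀ x ∈ S, ⟪x, y⟫ ≤ 1}

/-- `ω_k`, the `k`-dimensional volume of the Euclidean unit ball of `ℝ^k`. -/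
def unitBallVolume (k : ℕ) : ℝ≥0∞ :=
  volume (Metric.closedBall (0 : E k) 1)

/-- `u` is an outer unit normal of `K` at `x`. -/
def IsOuterUnitNormal {d : ℕ} (K : Set (E d)) (x u : E d) : Prop :=
  ‖u‖ = 1 ∧ ∀ z ∈ K, ⟪u, z - x⟫ ≤ 0

/-- The smooth boundary points of `K`: those with exactly one outer unit normal. -/
def smoothBoundary {d : ℕ} (K : Set (E d)) : Set (E d) :=
  {x | x ∈ frontier K ∧ ∃! u, IsOuterUnitNormal K x u}

open Classical in
/-- The outer unit normal of `K` at a smooth boundary point (and `0` at every other point). -/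
def outerNormal {d : ℕ} (K : Set (E d)) (x : E d) : E d :=
  if h : x ∈ smoothBoundary K then h.2.choose else 0

/-- The tangent space of `∂K` at a smooth boundary point `x`, as a linear hyperplane. -/
def tangentSpace {d : ℕ} (K : Set (E d)) (x : E d) : Submodule ℝ (E d) :=
  (Submodule.span ℝ {outerNormal K x})ᗮ

/-- The Holmes–Thompson volume density `λ_d(D°) / ω_d` of a Finsler ball `D`. -/
def volumeDensity {d : ℕ} (D : Set (E d)) : ℝ≥0∞ :=
  volume (polarBody D) / unitBallVolume d

/-- The Holmes–Thompson area density `λ_{d-1}((D ∩ T)°_T) / ω_{d-1}` of a Finsler ball `D` along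
a tangent hyperplane `T`. Here `λ_{d-1} = μHE[d - 1]` is Hausdorff measure on `ℝ^d`, normalized to
agree with Lebesgue measure on `(d-1)`-dimensional subspaces. -/
def areaDensity {d : ℕ} (D : Set (E d)) (T : Submodule ℝ (E d)) : ℝ≥0∞ :=
  μHE[d - 1] (polarIn T (D ∩ T)) / unitBallVolume (d - 1)

/-- The Funk Finsler structure `F_K(x, v) = ‖v‖_{K - x}` (gauge of the translate `K - x`). -/
def funkFinsler {d : ℕ} (K : Set (E d)) (x v : E d) : ℝ :=
  gauge ((fun z => z - x) '' K) v

/-- The Funk Finsler ball at `x`, the closed unit ball of `F_K(x, ·)`. -/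
def funkBall {d : ℕ} (K : Set (E d)) (x : E d) : Set (E d) :=
  {v | funkFinsler K x v ≤ 1}

/-- The Holmes–Thompson volume of `U` in the Funk geometry of `K`. -/
def funkVolume {d : ℕ} (K U : Set (E d)) : ℝ≥0∞ :=
  ∫⁻ x in U, volumeDensity (funkBall K x)

/-- The Holmes–Thompson `(d-1)`-area, in the Funk geometry of `K`, of the boundary of a convex
body `G`. The density is integrated over the smooth boundary points of `G` with respect to
`(d-1)`-dimensional Hausdorff measure. -/
def funkArea {d : ℕ} (K G : Set (E d)) : ℝ≥0∞ :=
  ∫⁻ x in smoothBoundary G, areaDensity (funkBall K x) (tangentSpace G x) ∂μHE[d - 1]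

end HolmesThompson

end

namespace HolmesThompson

open Metric Filter Topology Module

section SupportFunction

variable {V : Type*} [NormedAddCommGroup V] [InnerProductSpace ℝ V] {A : Set V}

/-- The support function `w ↦ sup_{a ∈ A} ⟪a, w⟫` of a set `A`. For compact `A ∋ 0` its unit
sublevel set is the polar of `A`, and for a polar `A = G°` it is the gauge of `G`. -/
noncomputable def supportFun (A : Set V) (w : V) : ℝ := sSup ((fun a => ⟪a, w⟫) '' A)

lemma inner_le_supportFun (hA : IsCompact A) {a : V} (ha : a ∈ A) (w : V) :
    ⟪a, w⟫ ≤ supportFun A w :=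
  le_csSup (hA.image (by fun_prop)).bddAbove ⟨a, ha, rfl⟩

lemma exists_inner_eq_supportFun (hA : IsCompact A) (hne : A.Nonempty) (w : V) :
    ∃ a ∈ A, ⟪a, w⟫ = supportFun A w :=
  (hA.image (f := fun a => ⟪a, w⟫) (by fun_prop)).sSup_mem (hne.image _)

lemma supportFun_le_iff (hA : IsCompact A) (hne : A.Nonempty) {w : V} {c : ℝ} :
    supportFun A w ≤ c ↔ ∀ a ∈ A, ⟪a, w⟫ ≤ c :=
  (csSup_le_iff (hA.image (by fun_prop)).bddAbove (hne.image _)).trans forall_mem_image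

lemma supportFun_smul (hA : IsCompact A) (hne : A.Nonempty) {t : ℝ} (ht : 0 ≤ t) (w : V) :
    supportFun A (t • w) = t * supportFun A w := by
  apply le_antisymm
  · rw [supportFun_le_iff hA hne]
    intro a ha
    rw [inner_smul_right]
    exact mul_le_mul_of_nonneg_left (inner_le_supportFun hA ha w) ht
  · obtain ⟨a, ha, haw⟩ := exists_inner_eq_supportFun hA hne w
    rw [← haw, ← inner_smul_right]
    exact inner_le_supportFun hA ha _

lemma supportFun_zero (hA : IsCompact A) (hne : A.Nonempty) : supportFun A 0 = 0 := by
  simpa using supportFun_smul hA hne le_rfl 0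

lemma supportFun_add_le (hA : IsCompact A) (hne : A.Nonempty) (v w : V) :
    supportFun A (v + w) ≤ supportFun A v + supportFun A w := by
  rw [supportFun_le_iff hA hne]
  intro a ha
  rw [inner_add_right]
  exact add_le_add (inner_le_supportFun hA ha v) (inner_le_supportFun hA ha w)

lemma convexOn_supportFun (hA : IsCompact A) (hne : A.Nonempty) :
    ConvexOn ℝ univ (supportFun A) := by
  refine ⟨convex_univ, fun x _ y _ a b ha hb _ => (supportFun_add_le hA hne _ _).trans ?_⟩
  rw [supportFun_smul hA hne ha, supportFun_smul hA hne hb, smul_eq_mul, smul_eq_mul]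

lemma supportFun_le_mul_norm (hA : IsCompact A) (hne : A.Nonempty) {R : ℝ}
    (hR : ∀ a ∈ A, ‖a‖ ≤ R) (w : V) : supportFun A w ≤ R * ‖w‖ := by
  rw [supportFun_le_iff hA hne]
  exact fun a ha =>
    (real_inner_le_norm a w).trans (mul_le_mul_of_nonneg_right (hR a ha) (norm_nonneg _))

lemma exists_lipschitzWith_supportFun (hA : IsCompact A) (hne : A.Nonempty) :
    ∃ C, LipschitzWith C (supportFun A) := by
  obtain ⟨R, hR⟩ := hA.isBounded.exists_norm_le
  refine ⟨R.toNNReal, LipschitzWith.of_le_add_mul _ fun x y => ?_⟩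
  calc supportFun A x = supportFun A (y + (x - y)) := by rw [add_sub_cancel]
    _ ≤ supportFun A y + supportFun A (x - y) := supportFun_add_le hA hne _ _
    _ ≤ supportFun A y + R.toNNReal * dist x y := by
      rw [dist_eq_norm]
      gcongr
      exact supportFun_le_mul_norm hA hne (fun a ha => (hR a ha).trans R.le_coe_toNNReal) _

lemma continuous_supportFun (hA : IsCompact A) (hne : A.Nonempty) : Continuous (supportFun A) :=
  (exists_lipschitzWith_supportFun hA hne).choose_spec.continuous

lemma exists_mul_norm_le_supportFun (hA : IsCompact A) (h0 : 0 ∈ interior A) :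
    ∃ r > 0, ∀ w, r * ‖w‖ ≤ supportFun A w := by
  obtain ⟨r, hr, hsub⟩ := nhds_basis_closedBall.mem_iff.1 (mem_interior_iff_mem_nhds.1 h0)
  refine ⟨r, hr, fun w => ?_⟩
  rcases eq_or_ne w 0 with rfl | hw
  · simp [supportFun_zero hA ⟨0, interior_subset h0⟩]
  have hw' : ‖w‖ ≠ 0 := norm_ne_zero_iff.2 hw
  have hmem : (r / ‖w‖) • w ∈ A := by
    apply hsub
    rw [mem_closedBall_zero_iff, norm_smul, Real.norm_of_nonneg (by positivity),
      div_mul_cancel₀ _ hw']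
  calc r * ‖w‖ = ⟪(r / ‖w‖) • w, w⟫ := by
        rw [real_inner_smul_left, real_inner_self_eq_norm_sq]
        field_simp
    _ ≤ supportFun A w := inner_le_supportFun hA hmem w

lemma supportFun_nonneg (hA : IsCompact A) (h0 : 0 ∈ A) (w : V) : 0 ≤ supportFun A w := by
  simpa using inner_le_supportFun hA h0 w

lemma supportFun_pos (hA : IsCompact A) (h0 : 0 ∈ interior A) {w : V} (hw : w ≠ 0) :
    0 < supportFun A w := by
  obtain ⟨r, hr, hrw⟩ := exists_mul_norm_le_supportFun hA h0
  exact (mul_pos hr (norm_pos_iff.2 hw)).trans_le (hrw w)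

lemma supportFun_image_sub_const (hA : IsCompact A) (hne : A.Nonempty) (x w : V) :
    supportFun ((· - x) '' A) w = supportFun A w - ⟪x, w⟫ := by
  have hAx : IsCompact ((· - x) '' A) := hA.image (by fun_prop)
  apply le_antisymm
  · rw [supportFun_le_iff hAx (hne.image _)]
    rintro _ ⟨a, ha, rfl⟩
    rw [inner_sub_left]
    linarith [inner_le_supportFun hA ha w]
  · obtain ⟨a, ha, haw⟩ := exists_inner_eq_supportFun hA hne w
    rw [← haw, ← inner_sub_left]
    exact inner_le_supportFun hAx ⟨a, ha, rfl⟩ w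

/-! ### Differentiability of support functions -/

lemma tendsto_maximizer_of_unique (hA : IsCompact A) (hne : A.Nonempty) {m : V → V}
    (hm : ∀ v, m v ∈ A) (hmax : ∀ v, ⟪m v, v⟫ = supportFun A v) {x p : V}
    (hunique : ∀ q ∈ A, ⟪q, x⟫ = supportFun A x → q = p) : Tendsto m (𝓝 x) (𝓝 p) := by
  refine hA.tendsto_nhds_of_unique_mapClusterPt (Eventually.of_forall hm) fun q hq hcluster =>
    hunique q hq (le_antisymm (inner_le_supportFun hA hq x) ?_)
  have hclosed : IsClosed {z : V × V | supportFun A z.2 ≤ ⟪z.1, z.2⟫} :=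
    isClosed_le ((continuous_supportFun hA hne).comp continuous_snd) (by fun_prop)
  have hcluster' : MapClusterPt (q, x) (𝓝 x) fun v => (m v, v) := by
    rw [mapClusterPt_iff_ultrafilter] at hcluster ⊢
    obtain ⟨U, hU, hq⟩ := hcluster
    exact ⟨U, hU, hq.prodMk_nhds hU⟩
  exact hclosed.mem_of_mapClusterPt hcluster' (Eventually.of_forall fun v => (hmax v).ge)

lemma ae_differentiableAt_supportFun [FiniteDimensional ℝ V] [MeasurableSpace V] [BorelSpace V]
    (hA : IsCompact A) (hne : A.Nonempty) : ∀ᵐ x, DifferentiableAt ℝ (supportFun A) x :=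
  (exists_lipschitzWith_supportFun hA hne).choose_spec.ae_differentiableAt

/-- The smooth points of the level surface `{supportFun A = 1}`; for `A = G°` they are the
smooth boundary points of `G`. -/
def smoothLevel (A : Set V) : Set V :=
  {x | supportFun A x = 1 ∧ DifferentiableAt ℝ (supportFun A) x}

lemma measurableSet_smoothLevel [MeasurableSpace V] [BorelSpace V] (hA : IsCompact A)
    (hne : A.Nonempty) : MeasurableSet (smoothLevel A) :=
  (measurableSet_eq_fun (continuous_supportFun hA hne).measurable measurable_const).inter
    (measurableSet_of_differentiableAt ℝ _)

variable [CompleteSpace V]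

lemma hasGradientAt_supportFun_of_unique (hA : IsCompact A) {x p : V} (hp : p ∈ A)
    (hunique : ∀ q ∈ A, ⟪q, x⟫ = supportFun A x → q = p) : HasGradientAt (supportFun A) p x := by
  have hne : A.Nonempty := ⟨p, hp⟩
  choose m hm hmax using exists_inner_eq_supportFun hA hne
  have hpx : ⟪p, x⟫ = supportFun A x := hunique _ (hm x) (hmax x) ▸ hmax x
  have htendsto := tendsto_maximizer_of_unique hA hne hm hmax hunique
  rw [hasGradientAt_iff_isLittleO, Asymptotics.isLittleO_iff]
  intro c hc
  filter_upwards [htendsto (closedBall_mem_nhds p hc)] with v hv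
  have hlower : 0 ≤ supportFun A v - supportFun A x - ⟪p, v - x⟫ := by
    rw [inner_sub_right, hpx]
    linarith [inner_le_supportFun hA hp v]
  rw [Real.norm_of_nonneg hlower]
  calc supportFun A v - supportFun A x - ⟪p, v - x⟫
      ≤ ⟪m v, v⟫ - ⟪m v, x⟫ - ⟪p, v - x⟫ := by
        rw [hmax v]
        linarith [inner_le_supportFun hA (hm v) x]
    _ = ⟪m v - p, v - x⟫ := by rw [inner_sub_left, inner_sub_right (m v)]
    _ ≤ ‖m v - p‖ * ‖v - x‖ := real_inner_le_norm _ _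
    _ ≤ c * ‖v - x‖ := by
        gcongr
        exact mem_closedBall_iff_norm.1 hv

lemma eq_gradient_of_inner_eq_supportFun (hA : IsCompact A) {x p : V}
    (hd : DifferentiableAt ℝ (supportFun A) x) (hp : p ∈ A) (hpx : ⟪p, x⟫ = supportFun A x) :
    p = gradient (supportFun A) x := by
  have hmin : IsLocalMin (fun v => supportFun A v - ⟪p, v⟫) x :=
    Eventually.of_forall fun v => by
      simp only [hpx, sub_self]
      linarith [inner_le_supportFun hA hp v]
  have hderiv := hd.hasGradientAt.hasFDerivAt.sub (innerSL ℝ p).hasFDerivAt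
  have hzero := hmin.hasFDerivAt_eq_zero hderiv
  refine ext_inner_right ℝ fun v => ?_
  have hzero_apply : fderiv ℝ (supportFun A) x v - ⟪p, v⟫ = 0 := by
    simpa using congrArg (fun L : V →L[ℝ] ℝ => L v) hzero
  rw [inner_gradient_left, sub_eq_zero.1 hzero_apply]

lemma gradient_supportFun_mem (hA : IsCompact A) (hne : A.Nonempty) {x : V}
    (hd : DifferentiableAt ℝ (supportFun A) x) : gradient (supportFun A) x ∈ A := by
  obtain ⟨p, hp, hpx⟩ := exists_inner_eq_supportFun hA hne x
  exact eq_gradient_of_inner_eq_supportFun hA hd hp hpx ▸ hp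

lemma inner_gradient_supportFun (hA : IsCompact A) (hne : A.Nonempty) {x : V}
    (hd : DifferentiableAt ℝ (supportFun A) x) :
    ⟪gradient (supportFun A) x, x⟫ = supportFun A x := by
  obtain ⟨p, hp, hpx⟩ := exists_inner_eq_supportFun hA hne x
  exact eq_gradient_of_inner_eq_supportFun hA hd hp hpx ▸ hpx

lemma inner_gradient_of_mem_smoothLevel (hA : IsCompact A) (hne : A.Nonempty) {x : V}
    (hx : x ∈ smoothLevel A) : ⟪gradient (supportFun A) x, x⟫ = 1 :=
  (inner_gradient_supportFun hA hne hx.2).trans hx.1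

lemma gradient_ne_zero_of_mem_smoothLevel (hA : IsCompact A) (hne : A.Nonempty) {x : V}
    (hx : x ∈ smoothLevel A) : gradient (supportFun A) x ≠ 0 := fun hzero => by
  have hinner := inner_gradient_of_mem_smoothLevel hA hne hx
  rw [hzero, inner_zero_left] at hinner
  exact zero_ne_one hinner

lemma hasGradientAt_supportFun_smul (hA : IsCompact A) (hne : A.Nonempty) {x : V} {t : ℝ}
    (ht : 0 < t) (hd : DifferentiableAt ℝ (supportFun A) x) :
    HasGradientAt (supportFun A) (gradient (supportFun A) x) (t • x) := by
  refine hasGradientAt_supportFun_of_unique hA (gradient_supportFun_mem hA hne hd) fun q hq hqx =>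
    eq_gradient_of_inner_eq_supportFun hA hd hq ?_
  rw [inner_smul_right, supportFun_smul hA hne ht.le] at hqx
  exact mul_left_cancel₀ ht.ne' hqx

lemma differentiableAt_supportFun_smul_iff (hA : IsCompact A) (hne : A.Nonempty) {x : V} {t : ℝ}
    (ht : 0 < t) :
    DifferentiableAt ℝ (supportFun A) (t • x) ↔ DifferentiableAt ℝ (supportFun A) x := by
  refine ⟨fun hd => ?_, fun hd => (hasGradientAt_supportFun_smul hA hne ht hd).differentiableAt⟩
  simpa [smul_smul, inv_mul_cancel₀ ht.ne'] using
    (hasGradientAt_supportFun_smul hA hne (inv_pos.2 ht) hd).differentiableAt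

lemma gradient_supportFun_smul (hA : IsCompact A) (hne : A.Nonempty) {t : ℝ} (ht : 0 < t)
    (x : V) : gradient (supportFun A) (t • x) = gradient (supportFun A) x := by
  by_cases hd : DifferentiableAt ℝ (supportFun A) x
  · exact (hasGradientAt_supportFun_smul hA hne ht hd).gradient
  · rw [gradient_eq_zero_of_not_differentiableAt hd, gradient_eq_zero_of_not_differentiableAt]
    rwa [differentiableAt_supportFun_smul_iff hA hne ht]

lemma gradient_supportFun_image_sub_const (hA : IsCompact A) (hne : A.Nonempty) (x : V) {w : V}
    (hd : DifferentiableAt ℝ (supportFun A) w) :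
    gradient (supportFun ((· - x) '' A)) w = gradient (supportFun A) w - x := by
  have hd' : DifferentiableAt ℝ (supportFun ((· - x) '' A)) w := by
    simp only [funext (supportFun_image_sub_const hA hne x)]
    exact hd.sub (innerSL ℝ x).differentiableAt
  refine (eq_gradient_of_inner_eq_supportFun (hA.image (by fun_prop)) hd'
    ⟨_, gradient_supportFun_mem hA hne hd, rfl⟩ ?_).symm
  rw [inner_sub_left, inner_gradient_supportFun hA hne hd, supportFun_image_sub_const hA hne]

end SupportFunction

section PolarBody

variable {d : ℕ} {A G K : Set (E d)} {x : E d}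

lemma polarBody_eq_supportFun_le_one (hA : IsCompact A) (hne : A.Nonempty) :
    polarBody A = {w | supportFun A w ≤ 1} :=
  Set.ext fun _ => (supportFun_le_iff hA hne).symm

lemma isClosed_polarBody (A : Set (E d)) : IsClosed (polarBody A) := by
  simp only [polarBody, ofPred_forall]
  exact isClosed_biInter fun x _ => isClosed_le (by fun_prop) continuous_const

lemma convex_polarBody (A : Set (E d)) : Convex ℝ (polarBody A) := by
  intro x hx y hy a b ha hb hab z hz
  rw [inner_add_right, inner_smul_right, inner_smul_right]
  linarith [mul_le_mul_of_nonneg_left (hx z hz) ha, mul_le_mul_of_nonneg_left (hy z hz) hb]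

lemma zero_mem_polarBody (A : Set (E d)) : 0 ∈ polarBody A := fun x _ => by simp

lemma nonempty_polarBody (A : Set (E d)) : (polarBody A).Nonempty := ⟨0, zero_mem_polarBody A⟩

lemma isCompact_polarBody (hA : IsCompact A) (h0 : 0 ∈ interior A) :
    IsCompact (polarBody A) := by
  obtain ⟨r, hr, hrw⟩ := exists_mul_norm_le_supportFun hA h0
  refine isCompact_of_isClosed_isBounded (isClosed_polarBody A)
    (isBounded_iff_forall_norm_le.2 ⟨1 / r, fun w hw => ?_⟩)
  rw [polarBody_eq_supportFun_le_one hA ⟨0, interior_subset h0⟩] at hw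
  exact (le_div_iff₀' hr).2 ((hrw w).trans hw)

lemma zero_mem_interior_polarBody (hA : IsCompact A) (hne : A.Nonempty) :
    0 ∈ interior (polarBody A) := by
  rw [mem_interior_iff_mem_nhds, polarBody_eq_supportFun_le_one hA hne]
  exact (continuous_supportFun hA hne).continuousAt.eventually_le_const
    (by simp [supportFun_zero hA hne])

lemma IsConvexBody.polarBody (hA : IsConvexBody A) (h0 : 0 ∈ interior A) :
    IsConvexBody (polarBody A) where
  isCompact := isCompact_polarBody hA.isCompact h0
  convex := convex_polarBody A
  nonempty_interior := ⟨0, zero_mem_interior_polarBody hA.isCompact ⟨0, interior_subset h0⟩⟩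

lemma exists_mem_polarBody_one_lt_inner (hclosed : IsClosed A) (hconv : Convex ℝ A) (h0 : 0 ∈ A)
    (hx : x ∉ A) : ∃ w ∈ polarBody A, 1 < ⟪x, w⟫ := by
  obtain ⟨f, u, hfu, hux⟩ := geometric_hahn_banach_closed_point hconv hclosed hx
  have hu : 0 < u := by simpa using hfu 0 h0
  set v := (InnerProductSpace.toDual ℝ (E d)).symm f with hv
  have hfv (z : E d) : f z = ⟪z, v⟫ := by
    rw [real_inner_comm, hv, InnerProductSpace.toDual_symm_apply]
  refine ⟨u⁻¹ • v, fun z hz => ?_, ?_⟩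
  · rw [inner_smul_right, ← hfv, inv_mul_le_iff₀ hu, mul_one]
    exact (hfu z hz).le
  · rwa [inner_smul_right, ← hfv, lt_inv_mul_iff₀ hu, mul_one]

theorem polarBody_polarBody (hclosed : IsClosed A) (hconv : Convex ℝ A) (h0 : 0 ∈ A) :
    polarBody (polarBody A) = A := by
  ext x
  refine ⟨fun hx => ?_, fun hx w hw => real_inner_comm x w ▸ hw x hx⟩
  by_contra hxA
  obtain ⟨w, hw, hxw⟩ := exists_mem_polarBody_one_lt_inner hclosed hconv h0 hxA
  exact hxw.not_ge (real_inner_comm x w ▸ hx w hw)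

lemma IsConvexBody.polarBody_polarBody (hG : IsConvexBody G) (h0 : 0 ∈ interior G) :
    HolmesThompson.polarBody (HolmesThompson.polarBody G) = G :=
  HolmesThompson.polarBody_polarBody hG.isCompact.isClosed hG.convex (interior_subset h0)

lemma mem_iff_supportFun_polarBody_le_one (hG : IsConvexBody G) (h0 : 0 ∈ interior G) :
    x ∈ G ↔ supportFun (polarBody G) x ≤ 1 := by
  conv_lhs => rw [← hG.polarBody_polarBody h0,
    polarBody_eq_supportFun_le_one (isCompact_polarBody hG.isCompact h0) (nonempty_polarBody G)]
  rfl

lemma supportFun_polarBody_eq_gauge (hG : IsConvexBody G) (h0 : 0 ∈ interior G) (x : E d) :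
    supportFun (polarBody G) x = gauge G x := by
  have hcompact := isCompact_polarBody hG.isCompact h0
  have le_iff {t : ℝ} (ht : 0 < t) : supportFun (polarBody G) x ≤ t ↔ gauge G x ≤ t := by
    have hmem : t⁻¹ • x ∈ G ↔ gauge G (t⁻¹ • x) ≤ 1 := by
      rw [gauge_le_one_iff_mem_closure hG.convex (mem_interior_iff_mem_nhds.1 h0),
        hG.isCompact.isClosed.closure_eq]
    rwa [mem_iff_supportFun_polarBody_le_one hG h0, gauge_smul_of_nonneg (inv_nonneg.2 ht.le),
      supportFun_smul hcompact (nonempty_polarBody G) (inv_nonneg.2 ht.le), smul_eq_mul,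
      inv_mul_le_iff₀ ht, inv_mul_le_iff₀ ht, mul_one] at hmem
  refine le_antisymm (le_of_forall_gt_imp_ge_of_dense fun t ht => ?_)
    (le_of_forall_gt_imp_ge_of_dense fun t ht => ?_)
  · exact (le_iff ((gauge_nonneg x).trans_lt ht)).2 ht.le
  · exact (le_iff ((supportFun_nonneg hcompact (zero_mem_polarBody G) x).trans_lt ht)).1 ht.le

lemma supportFun_polarBody_lt_one (hG : IsConvexBody G) (h0 : 0 ∈ interior G)
    (hx : x ∈ interior G) : supportFun (polarBody G) x < 1 := by
  rw [supportFun_polarBody_eq_gauge hG h0]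
  exact (gauge_lt_one_iff_mem_interior hG.convex (mem_interior_iff_mem_nhds.1 h0)).2 hx

lemma mem_frontier_iff_supportFun_polarBody (hG : IsConvexBody G) (h0 : 0 ∈ interior G) :
    x ∈ frontier G ↔ supportFun (polarBody G) x = 1 := by
  rw [supportFun_polarBody_eq_gauge hG h0,
    gauge_eq_one_iff_mem_frontier hG.convex (mem_interior_iff_mem_nhds.1 h0)]

lemma polarBody_subset_interior_polarBody (hG : IsCompact G) (h0G : 0 ∈ G) (hK : IsConvexBody K)
    (h0K : 0 ∈ interior K) (hGK : G ⊆ interior K) : polarBody K ⊆ interior (polarBody G) := by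
  intro z hz
  have hlt : supportFun G z < 1 := by
    obtain ⟨x, hx, hxz⟩ := exists_inner_eq_supportFun hG ⟨0, h0G⟩ z
    calc supportFun G z = ⟪z, x⟫ := by rw [real_inner_comm, hxz]
      _ ≤ supportFun (polarBody K) x :=
        inner_le_supportFun (isCompact_polarBody hK.isCompact h0K) hz x
      _ < 1 := supportFun_polarBody_lt_one hK h0K (hGK hx)
  rw [mem_interior_iff_mem_nhds, polarBody_eq_supportFun_le_one hG ⟨0, h0G⟩]
  exact (continuous_supportFun hG ⟨0, h0G⟩).continuousAt.eventually_le_const hlt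

/-! ### Smooth boundary points -/

lemma exists_mem_polarBody_of_isOuterUnitNormal (hG : IsConvexBody G) (h0 : 0 ∈ interior G)
    {u : E d} (hx : x ∈ G) (hu : IsOuterUnitNormal G x u) :
    ∃ p ∈ polarBody G, ⟪p, x⟫ = 1 ∧ u = ‖p‖⁻¹ • p := by
  obtain ⟨hnorm, hnormal⟩ := hu
  have hmax (z : E d) (hz : z ∈ G) : ⟪z, u⟫ ≤ ⟪x, u⟫ := by
    have := hnormal z hz
    rw [inner_sub_right, real_inner_comm, real_inner_comm x] at this
    linarith
  have hpos : 0 < ⟪x, u⟫ :=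
    (supportFun_pos hG.isCompact h0 (norm_ne_zero_iff.1 (hnorm ▸ one_ne_zero))).trans_le
      ((supportFun_le_iff hG.isCompact ⟨x, hx⟩).2 hmax)
  refine ⟨⟪x, u⟫⁻¹ • u, fun z hz => ?_, ?_, ?_⟩
  · rw [inner_smul_right, inv_mul_le_iff₀ hpos, mul_one]
    exact hmax z hz
  · rw [real_inner_smul_left, real_inner_comm x u, inv_mul_cancel₀ hpos.ne']
  · rw [norm_smul, hnorm, norm_inv, Real.norm_of_nonneg hpos.le, mul_one, inv_inv, smul_smul,
      mul_inv_cancel₀ hpos.ne', one_smul]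

lemma isOuterUnitNormal_of_mem_polarBody {p : E d} (hp : p ∈ polarBody G) (hpx : ⟪p, x⟫ = 1) :
    IsOuterUnitNormal G x (‖p‖⁻¹ • p) := by
  have hp0 : p ≠ 0 := fun h => by simp [h] at hpx
  refine ⟨by rw [norm_smul, norm_inv, norm_norm, inv_mul_cancel₀ (norm_ne_zero_iff.2 hp0)],
    fun z hz => ?_⟩
  rw [real_inner_smul_left, inner_sub_right, hpx, real_inner_comm]
  exact mul_nonpos_of_nonneg_of_nonpos (by positivity) (sub_nonpos.2 (hp z hz))

lemma eq_of_inv_norm_smul_eq {p q : E d} (hp : ⟪p, x⟫ = 1) (hq : ⟪q, x⟫ = 1)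
    (hpq : ‖q‖⁻¹ • q = ‖p‖⁻¹ • p) : q = p := by
  have hnorm : ‖q‖⁻¹ = ‖p‖⁻¹ := by
    simpa [real_inner_smul_left, hp, hq] using congrArg (⟪·, x⟫) hpq
  have hp0 : ‖p‖⁻¹ ≠ 0 := inv_ne_zero (norm_ne_zero_iff.2 fun h => by simp [h] at hp)
  exact smul_right_injective _ hp0 (hnorm ▸ hpq)

lemma smoothBoundary_eq_smoothLevel (hG : IsConvexBody G) (h0 : 0 ∈ interior G) :
    smoothBoundary G = smoothLevel (polarBody G) := by
  have hcompact := isCompact_polarBody hG.isCompact h0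
  ext x
  simp only [smoothBoundary, smoothLevel, mem_ofPred_eq,
    mem_frontier_iff_supportFun_polarBody hG h0]
  refine and_congr_right fun hx => ⟨?_, fun hd => ?_⟩
  · rintro ⟨u, -, hu⟩
    obtain ⟨p, hp, hpx⟩ := exists_inner_eq_supportFun hcompact (nonempty_polarBody G) x
    refine (hasGradientAt_supportFun_of_unique hcompact hp fun q hq hqx => ?_).differentiableAt
    rw [hx] at hpx hqx
    exact eq_of_inv_norm_smul_eq hpx hqx
      ((hu _ (isOuterUnitNormal_of_mem_polarBody hq hqx)).trans
        (hu _ (isOuterUnitNormal_of_mem_polarBody hp hpx)).symm)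
  · refine ⟨_, isOuterUnitNormal_of_mem_polarBody
      (gradient_supportFun_mem hcompact (nonempty_polarBody G) hd)
      ((inner_gradient_supportFun hcompact (nonempty_polarBody G) hd).trans hx), fun u hu => ?_⟩
    have hxG : x ∈ G := (mem_iff_supportFun_polarBody_le_one hG h0).2 hx.le
    obtain ⟨p, hp, hpx, rfl⟩ := exists_mem_polarBody_of_isOuterUnitNormal hG h0 hxG hu
    rw [eq_gradient_of_inner_eq_supportFun hcompact hd hp (hpx.trans hx.symm)]

lemma outerNormal_eq (hG : IsConvexBody G) (h0 : 0 ∈ interior G) (hx : x ∈ smoothBoundary G) :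
    outerNormal G x = ‖gradient (supportFun (polarBody G)) x‖⁻¹ •
      gradient (supportFun (polarBody G)) x := by
  have hcompact := isCompact_polarBody hG.isCompact h0
  have hlevel : x ∈ smoothLevel (polarBody G) := smoothBoundary_eq_smoothLevel hG h0 ▸ hx
  rw [outerNormal, dif_pos hx]
  exact hx.2.unique hx.2.choose_spec.1 (isOuterUnitNormal_of_mem_polarBody
    (gradient_supportFun_mem hcompact (nonempty_polarBody G) hlevel.2)
    (inner_gradient_of_mem_smoothLevel hcompact (nonempty_polarBody G) hlevel))

/-! ### Funk balls -/

lemma zero_mem_interior_image_sub_const (hx : x ∈ interior K) :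
    (0 : E d) ∈ interior ((· - x) '' K) :=
  ((Homeomorph.subRight x).image_interior K).subset ⟨x, hx, sub_self x⟩

lemma IsConvexBody.image_sub_const (hK : IsConvexBody K) (x : E d) :
    IsConvexBody ((· - x) '' K) where
  isCompact := hK.isCompact.image (by fun_prop)
  convex := by simpa [sub_eq_add_neg, add_comm] using hK.convex.translate (-x)
  nonempty_interior :=
    (hK.nonempty_interior.image _).mono ((Homeomorph.subRight x).image_interior K).subset

lemma funkBall_eq (hK : IsConvexBody K) (hx : x ∈ interior K) :
    funkBall K x = (· - x) '' K := by
  have hKx := hK.image_sub_const x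
  ext v
  rw [funkBall, mem_ofPred_eq, funkFinsler, gauge_le_one_iff_mem_closure hKx.convex
    (mem_interior_iff_mem_nhds.1 (zero_mem_interior_image_sub_const hx)),
    hKx.isCompact.isClosed.closure_eq]

end PolarBody

section Volume

section PolarProjection

variable {V : Type*} [NormedAddCommGroup V] [InnerProductSpace ℝ V] {x z : V}

/-- The projective map `z ↦ z / (1 - ⟪x, z⟫)`. It carries the polar of `K` onto the polar of the
translate `K - x`. -/
noncomputable def polarProjection (x z : V) : V := (1 - ⟪x, z⟫)⁻¹ • z

lemma one_add_inner_polarProjection (hz : ⟪x, z⟫ ≠ 1) :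
    1 + ⟪x, polarProjection x z⟫ = (1 - ⟪x, z⟫)⁻¹ := by
  have hs : 1 - ⟪x, z⟫ ≠ 0 := sub_ne_zero.2 hz.symm
  rw [polarProjection, inner_smul_right]
  field_simp
  ring

lemma injOn_polarProjection (x : V) : InjOn (polarProjection x) {z | ⟪x, z⟫ ≠ 1} := by
  refine LeftInvOn.injOn (f₁' := fun w => (1 + ⟪x, w⟫)⁻¹ • w) fun z hz => ?_
  beta_reduce
  rw [one_add_inner_polarProjection hz, polarProjection, inv_inv,
    smul_inv_smul₀ (sub_ne_zero.2 hz.symm)]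

lemma hasFDerivAt_polarProjection (hz : ⟪x, z⟫ ≠ 1) :
    HasFDerivAt (polarProjection x) ((1 - ⟪x, z⟫)⁻¹ •
      (ContinuousLinearMap.id ℝ V + ((1 - ⟪x, z⟫)⁻¹ • innerSL ℝ x).smulRight z)) z := by
  have hs : 1 - ⟪x, z⟫ ≠ 0 := sub_ne_zero.2 hz.symm
  have hinv : HasFDerivAt (fun z => (1 - ⟪x, z⟫)⁻¹) (-((1 - ⟪x, z⟫) ^ 2)⁻¹ • -innerSL ℝ x) z :=
    (hasDerivAt_inv hs).comp_hasFDerivAt z ((innerSL ℝ x).hasFDerivAt.const_sub 1)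
  refine (hinv.smul (hasFDerivAt_id z)).congr_fderiv (ContinuousLinearMap.ext fun v => ?_)
  simp [smul_smul, pow_two, mul_assoc]

lemma det_id_add_smulRight [FiniteDimensional ℝ V] (f : V →L[ℝ] ℝ) (z : V) :
    (ContinuousLinearMap.id ℝ V + f.smulRight z).det = 1 + f z :=
  LinearMap.transvection.det (f : Module.Dual ℝ V) z

lemma volume_image_polarProjection [FiniteDimensional ℝ V] [MeasurableSpace V] [BorelSpace V]
    {P : Set V} (hP : MeasurableSet P) (hlt : ∀ z ∈ P, ⟪x, z⟫ < 1) :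
    volume (polarProjection x '' P) =
      ∫⁻ z in P, ENNReal.ofReal (((1 - ⟪x, z⟫) ^ (Module.finrank ℝ V + 1))⁻¹) := by
  rw [← lintegral_abs_det_fderiv_eq_addHaar_image volume hP
    (fun z hz => (hasFDerivAt_polarProjection (hlt z hz).ne).hasFDerivWithinAt)
    ((injOn_polarProjection x).mono fun z hz => (hlt z hz).ne)]
  refine setLIntegral_congr_fun hP fun z hz => ?_
  have hs : 0 < 1 - ⟪x, z⟫ := sub_pos.2 (hlt z hz)
  have hdet : ((1 - ⟪x, z⟫)⁻¹ •
      (ContinuousLinearMap.id ℝ V + ((1 - ⟪x, z⟫)⁻¹ • innerSL ℝ x).smulRight z)).det =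
      ((1 - ⟪x, z⟫) ^ (Module.finrank ℝ V + 1))⁻¹ := by
    rw [ContinuousLinearMap.det, ContinuousLinearMap.toLinearMap_smul, LinearMap.det_smul,
      ← ContinuousLinearMap.det, det_id_add_smulRight, pow_succ, mul_inv, inv_pow]
    simp only [_root_.smul_apply, innerSL_apply_apply, smul_eq_mul]
    field_simp
    ring
  simp only [hdet, abs_of_nonneg (inv_nonneg.2 (pow_nonneg hs.le _))]

end PolarProjection

variable {d : ℕ} {G K : Set (E d)} {x : E d}

lemma inner_lt_one_of_mem_polarBody (hK : IsCompact K) (hx : x ∈ interior K) {z : E d}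
    (hz : z ∈ polarBody K) : ⟪x, z⟫ < 1 := by
  rcases eq_or_ne z 0 with rfl | hz0
  · simp
  have hpos : 0 < supportFun K z - ⟪x, z⟫ := by
    rw [← supportFun_image_sub_const hK ⟨x, interior_subset hx⟩]
    exact supportFun_pos (hK.image (by fun_prop)) (zero_mem_interior_image_sub_const hx) hz0
  have := (supportFun_le_iff hK ⟨x, interior_subset hx⟩).2 hz
  linarith

lemma polarBody_image_sub_const (hK : IsCompact K) (h0 : 0 ∈ interior K) (hx : x ∈ interior K) :
    polarBody ((· - x) '' K) = polarProjection x '' polarBody K := by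
  have hne : K.Nonempty := ⟨x, interior_subset hx⟩
  apply Subset.antisymm
  · intro w hw
    have hle : supportFun K w ≤ 1 + ⟪x, w⟫ := by
      have := (supportFun_le_iff (hK.image (by fun_prop)) (hne.image _)).2 hw
      rw [supportFun_image_sub_const hK hne] at this
      linarith
    have hpos : 0 < 1 + ⟪x, w⟫ := by
      rcases eq_or_ne w 0 with rfl | hw0
      · simp
      · exact (supportFun_pos hK h0 hw0).trans_le hle
    refine ⟨(1 + ⟪x, w⟫)⁻¹ • w, fun a ha => ?_, ?_⟩
    · rw [inner_smul_right, inv_mul_le_iff₀ hpos, mul_one]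
      exact (inner_le_supportFun hK ha w).trans hle
    · have : 1 - (1 + ⟪x, w⟫)⁻¹ * ⟪x, w⟫ = (1 + ⟪x, w⟫)⁻¹ := by
        field_simp
        ring
      rw [polarProjection, inner_smul_right, this, smul_smul, inv_inv,
        mul_inv_cancel₀ hpos.ne', one_smul]
  · rintro _ ⟨z, hz, rfl⟩ _ ⟨a, ha, rfl⟩
    have hs : 0 < 1 - ⟪x, z⟫ := sub_pos.2 (inner_lt_one_of_mem_polarBody hK hx hz)
    rw [polarProjection, inner_smul_right, inner_sub_left, inv_mul_le_iff₀ hs, mul_one]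
    linarith [hz a ha]

lemma funkVolume_eq_lintegral (hK : IsConvexBody K) (h0 : 0 ∈ interior K)
    (hG : MeasurableSet G) (hGK : G ⊆ interior K) :
    funkVolume K G = (∫⁻ x in G, ∫⁻ z in polarBody K,
      ENNReal.ofReal (((1 - ⟪x, z⟫) ^ (d + 1))⁻¹)) / unitBallVolume d := by
  have hball : (unitBallVolume d)⁻¹ ≠ ∞ :=
    ENNReal.inv_ne_top.2 (measure_closedBall_pos _ _ one_pos).ne'
  rw [ENNReal.div_eq_inv_mul, ← lintegral_const_mul' _ _ hball, funkVolume]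
  refine setLIntegral_congr_fun hG fun x hx => ?_
  have hvolume := volume_image_polarProjection (isClosed_polarBody K).measurableSet
    fun z => inner_lt_one_of_mem_polarBody hK.isCompact (hGK hx)
  rw [finrank_euclideanSpace_fin] at hvolume
  beta_reduce
  rw [volumeDensity, funkBall_eq hK (hGK hx),
    polarBody_image_sub_const hK.isCompact h0 (hGK hx), hvolume, ENNReal.div_eq_inv_mul]

theorem funkVolume_polarBody_polarBody (hG : IsConvexBody G) (hK : IsConvexBody K)
    (h0 : 0 ∈ interior G) (hGK : G ⊆ interior K) :
    funkVolume (polarBody G) (polarBody K) = funkVolume K G := by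
  have h0K : 0 ∈ interior K := hGK (interior_subset h0)
  rw [funkVolume_eq_lintegral hK h0K hG.isCompact.measurableSet hGK,
    funkVolume_eq_lintegral (hG.polarBody h0)
      (zero_mem_interior_polarBody hG.isCompact ⟨0, interior_subset h0⟩)
      (isClosed_polarBody K).measurableSet
      (polarBody_subset_interior_polarBody hG.isCompact (interior_subset h0) hK h0K hGK),
    hG.polarBody_polarBody h0, lintegral_lintegral_swap]
  · simp only [real_inner_comm]
  · have : Measurable fun p : E d × E d => ⟪p.1, p.2⟫ := by fun_prop
    exact Measurable.aemeasurable (by fun_prop)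

end Volume

/-! ### Total variation of convex functions along lines -/

section Line

variable {f : ℝ → ℝ} {a b c t₀ : ℝ}

lemma lintegral_abs_deriv_Ioc (hf : ConvexOn ℝ univ f) (hmono : MonotoneOn f (Ici a))
    (hab : a ≤ b) :
    ∫⁻ t in Ioc a b, ENNReal.ofReal |deriv f t| = ENNReal.ofReal (f b - f a) := by
  have hderiv : ∀ t ∈ Ioc a b, 0 ≤ deriv f t := fun t ht => by
    rw [← derivWithin_of_mem_nhds (Ici_mem_nhds ht.1)]
    exact hmono.derivWithin_nonneg
  obtain ⟨C, hC⟩ :=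
    hf.locallyLipschitz.locallyLipschitzOn.exists_lipschitzOnWith_of_compact
      (isCompact_uIcc (a := a) (b := b))
  have hac := hC.absolutelyContinuousOnInterval
  rw [setLIntegral_congr_fun (g := fun t => ENNReal.ofReal (deriv f t)) measurableSet_Ioc
      fun t ht => by simp only [abs_of_nonneg (hderiv t ht)],
    ← ofReal_integral_eq_lintegral_ofReal hac.intervalIntegrable_deriv.1,
    ← intervalIntegral.integral_of_le hab, hac.integral_deriv_eq_sub]
  filter_upwards [ae_restrict_mem measurableSet_Ioc] with t ht using hderiv t ht

lemma monotoneOn_Ici_of_isMinOn (hf : ConvexOn ℝ univ f) (hmin : IsMinOn f univ t₀) :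
    MonotoneOn f (Ici t₀) := by
  intro s hs t _ hst
  have := hf.le_max_of_mem_Icc (mem_univ t₀) (mem_univ t) (z := s) ⟨hs, hst⟩
  rwa [max_eq_right (hmin (mem_univ t))] at this

lemma exists_sublevel_inter_Ioi_eq_Ioc (hf : ConvexOn ℝ univ f) (hmin : IsMinOn f univ t₀)
    (htop : Tendsto f atTop atTop) (hlt : f t₀ < c) :
    ∃ β ≥ t₀, f β = c ∧ {t | f t ≤ c} ∩ Ioi t₀ = Ioc t₀ β := by
  obtain ⟨b, hcb, hb⟩ := ((htop.eventually_ge_atTop c).and (eventually_ge_atTop t₀)).exists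
  obtain ⟨β, hβ, rfl⟩ :=
    intermediate_value_Icc hb hf.locallyLipschitz.continuous.continuousOn ⟨hlt.le, hcb⟩
  have hβ₀ : t₀ < β := hβ.1.lt_of_ne (by rintro rfl; exact hlt.ne rfl)
  refine ⟨β, hβ.1, rfl, Set.ext fun t => and_comm.trans (and_congr_right fun ht => ⟨fun hle => ?_,
    monotoneOn_Ici_of_isMinOn hf hmin (mem_Ici.2 (le_of_lt ht)) hβ.1⟩)⟩
  by_contra! hβt
  exact (hf.lt_right_of_left_lt (mem_univ t₀) (mem_univ t)
    (Ioo_subset_openSegment ⟨hβ₀, hβt⟩) hlt).not_ge hle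

lemma lintegral_abs_deriv_sublevel_inter_Ioi (hf : ConvexOn ℝ univ f)
    (hmin : IsMinOn f univ t₀) (htop : Tendsto f atTop atTop) (hlt : f t₀ < c) :
    ∫⁻ t in {t | f t ≤ c} ∩ Ioi t₀, ENNReal.ofReal |deriv f t| = ENNReal.ofReal (c - f t₀) := by
  obtain ⟨β, hβ, rfl, hsublevel⟩ := exists_sublevel_inter_Ioi_eq_Ioc hf hmin htop hlt
  rw [hsublevel, lintegral_abs_deriv_Ioc hf (monotoneOn_Ici_of_isMinOn hf hmin) hβ]

lemma lintegral_abs_deriv_sublevel_inter_Iic (hf : ConvexOn ℝ univ f)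
    (hmin : IsMinOn f univ t₀) (hbot : Tendsto f atBot atTop) (hlt : f t₀ < c) :
    ∫⁻ t in {t | f t ≤ c} ∩ Iic t₀, ENNReal.ofReal |deriv f t| = ENNReal.ofReal (c - f t₀) := by
  have hneg := lintegral_abs_deriv_sublevel_inter_Ioi (f := fun t => f (-t)) (t₀ := -t₀) (c := c)
    (hf.comp_linearMap (-LinearMap.id : ℝ →ₗ[ℝ] ℝ))
    (fun t _ => by simpa using hmin (mem_univ (-t))) (hbot.comp tendsto_neg_atTop_atBot)
    (by simpa using hlt)
  rw [neg_neg] at hneg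
  rw [← hneg,
    setLIntegral_congr (ae_eq_set_inter (ae_eq_refl {t | f t ≤ c}) Iio_ae_eq_Iic.symm),
    ← (Measure.measurePreserving_neg volume).setLIntegral_comp_preimage_emb
      (MeasurableEquiv.neg ℝ).measurableEmbedding]
  simp [deriv_comp_neg, preimage_inter, preimage_ofPred_eq]

lemma lintegral_abs_deriv_sublevel (hf : ConvexOn ℝ univ f)
    (hcoercive : Tendsto f (cocompact ℝ) atTop) (hmin : IsMinOn f univ t₀) :
    ∫⁻ t in {t | f t ≤ c}, ENNReal.ofReal |deriv f t| = ENNReal.ofReal (2 * (c - f t₀)) := by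
  rcases le_or_gt c (f t₀) with hle | hlt
  · have hzero : ∀ t ∈ {t | f t ≤ c}, ENNReal.ofReal |deriv f t| = 0 := fun t ht => by
      have hloc : IsLocalMin f t := Eventually.of_forall fun s =>
        le_trans ht (hle.trans (hmin (mem_univ s)))
      rw [hloc.deriv_eq_zero, abs_zero, ENNReal.ofReal_zero]
    have hmeas : MeasurableSet {t | f t ≤ c} :=
      measurableSet_le hf.locallyLipschitz.continuous.measurable measurable_const
    rw [setLIntegral_congr_fun hmeas hzero, lintegral_zero, ENNReal.ofReal_of_nonpos (by linarith)]
  · rw [← lintegral_inter_add_sdiff _ _ (measurableSet_Ioi (a := t₀)), sdiff_eq, compl_Ioi,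
      lintegral_abs_deriv_sublevel_inter_Ioi hf hmin
        (hcoercive.mono_left atTop_le_cocompact) hlt,
      lintegral_abs_deriv_sublevel_inter_Iic hf hmin
        (hcoercive.mono_left atBot_le_cocompact) hlt,
      ← ENNReal.ofReal_add (by linarith) (by linarith), two_mul]

end Line

/-! ### Slicing by lines -/

section Slicing

variable {V : Type*} [NormedAddCommGroup V] [InnerProductSpace ℝ V] {n : V}

lemma tendsto_add_smul_cocompact (y : V) (hn : ‖n‖ = 1) :
    Tendsto (fun t : ℝ => y + t • n) (cocompact ℝ) (cocompact V) := by
  have hiso : Isometry fun t : ℝ => y + t • n := Isometry.of_dist_eq fun s t => by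
    rw [dist_add_left, dist_eq_norm, ← sub_smul, norm_smul, hn, mul_one, dist_eq_norm]
  exact hiso.isClosedEmbedding.tendsto_cocompact

variable [FiniteDimensional ℝ V]

lemma finrank_orthogonal_span_singleton_add_one (hn : n ≠ 0) :
    finrank ℝ (ℝ ∙ n)ᗮ + 1 = finrank ℝ V := by
  rw [← (ℝ ∙ n).finrank_add_finrank_orthogonal, finrank_span_singleton hn, add_comm]

lemma inner_gradient_add_smul_eq_deriv {f : V → ℝ} {y : V} {t : ℝ}
    (hf : DifferentiableAt ℝ f (y + t • n)) :
    ⟪gradient f (y + t • n), n⟫ = deriv (fun t : ℝ => f (y + t • n)) t := by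
  have hline : HasDerivAt (fun t : ℝ => y + t • n) n t := by
    simpa using ((hasDerivAt_id t).smul_const n).const_add y
  rw [gradient, InnerProductSpace.toDual_symm_apply]
  exact (hf.hasFDerivAt.comp_hasDerivAt t hline).deriv.symm

variable [MeasurableSpace V] [BorelSpace V]

lemma measurable_gradient (f : V → ℝ) : Measurable (gradient f) :=
  (InnerProductSpace.toDual ℝ V).symm.continuous.measurable.comp (measurable_fderiv ℝ f)

lemma euclideanHausdorffMeasure_image_val (T : Submodule ℝ V) (s : Set T) :
    μHE[finrank ℝ T] (Subtype.val '' s : Set V) = volume s := by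
  rw [isometry_subtype_coe.euclideanHausdorffMeasure_image,
    InnerProductSpace.euclideanHausdorffMeasure_eq_volume]

lemma measurePreserving_add_smul (hn : ‖n‖ = 1) :
    MeasurePreserving (fun p : (ℝ ∙ n)ᗮ × ℝ => (p.1 : V) + p.2 • n)
      ((volume : Measure (ℝ ∙ n)ᗮ).prod volume) volume := by
  have hsum := ((ℝ ∙ n).measurePreserving_measurableEquivProd (0 : V)).symm
  rw [InnerProductSpace.euclideanHausdorffMeasure_eq_volume] at hsum
  have hline := (LinearIsometryEquiv.toSpanUnitSingleton (𝕜 := ℝ) n hn).measurePreserving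
  have hcomp := hsum.comp
    ((hline.prod (MeasurePreserving.id (volume : Measure (ℝ ∙ n)ᗮ))).comp
      Measure.measurePreserving_swap)
  refine hcomp.congr (Continuous.measurable (by fun_prop)) (Eventually.of_forall fun p => ?_)
  simp [add_comm]

lemma lintegral_eq_lintegral_orthogonal_lintegral (hn : ‖n‖ = 1) {F : V → ℝ≥0∞}
    (hF : Measurable F) : ∫⁻ x, F x = ∫⁻ y : (ℝ ∙ n)ᗮ, ∫⁻ t : ℝ, F (y + t • n) := by
  have hmp := measurePreserving_add_smul hn
  rw [← hmp.lintegral_comp hF]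
  exact lintegral_prod _ (hF.comp hmp.measurable).aemeasurable

lemma lintegral_abs_inner_gradient_sublevel {f : V → ℝ} (hf : ConvexOn ℝ univ f)
    (hdiff : ∀ᵐ x, DifferentiableAt ℝ f x) (hcoercive : Tendsto f (cocompact V) atTop)
    (hn : ‖n‖ = 1) {m : (ℝ ∙ n)ᗮ → ℝ}
    (hm : ∀ y : (ℝ ∙ n)ᗮ, IsLeast (range fun t : ℝ => f (y + t • n)) (m y)) (c : ℝ) :
    ∫⁻ x in {x | f x ≤ c}, ENNReal.ofReal |⟪gradient f x, n⟫| =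
      ∫⁻ y : (ℝ ∙ n)ᗮ, ENNReal.ofReal (2 * (c - m y)) := by
  have hsublevel : MeasurableSet {x | f x ≤ c} :=
    measurableSet_le hf.locallyLipschitz.continuous.measurable measurable_const
  have hF : Measurable fun x => ENNReal.ofReal |⟪gradient f x, n⟫| :=
    ((measurable_gradient f).inner measurable_const).abs.ennreal_ofReal
  rw [← lintegral_indicator hsublevel,
    lintegral_eq_lintegral_orthogonal_lintegral hn (hF.indicator hsublevel)]
  refine lintegral_congr_ae ?_
  filter_upwards [Measure.ae_ae_of_ae_prod
    ((measurePreserving_add_smul hn).quasiMeasurePreserving.ae hdiff)] with y hy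
  obtain ⟨⟨t₀, ht₀⟩, hmin⟩ := hm y
  set g : ℝ → ℝ := fun t => f (y + t • n)
  have hg : ConvexOn ℝ univ g := by
    simpa [g, Function.comp_def, AffineMap.lineMap_apply, add_comm] using
      hf.comp_affineMap (AffineMap.lineMap (y : V) (y + n))
  have hgmin : IsMinOn g univ t₀ := fun t _ => ht₀.trans_le (hmin ⟨t, rfl⟩)
  have hvariation := lintegral_abs_deriv_sublevel (c := c) hg
    (hcoercive.comp (tendsto_add_smul_cocompact (y : V) hn)) hgmin
  rw [← ht₀, ← hvariation, ← lintegral_indicator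
    (measurableSet_le hg.locallyLipschitz.continuous.measurable measurable_const)]
  refine lintegral_congr_ae ?_
  filter_upwards [hy] with t ht
  simp only [indicator, inner_gradient_add_smul_eq_deriv ht, mem_ofPred_eq, g]

end Slicing

section LayerCake

variable {F : Type*} [NormedAddCommGroup F] [NormedSpace ℝ F] [FiniteDimensional ℝ F]
  [MeasurableSpace F] [BorelSpace F] (μ : Measure F) [μ.IsAddHaarMeasure] {m : F → ℝ}

lemma measure_sublevel_of_homogeneous (hhom : ∀ y, ∀ t : ℝ, 0 < t → m (t • y) = t * m y) {s : ℝ}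
    (hs : 0 < s) : μ {y | m y ≤ s} = ENNReal.ofReal (s ^ finrank ℝ F) * μ {y | m y ≤ 1} := by
  rw [← Measure.addHaar_smul_of_nonneg _ hs.le]
  congr 1
  ext y
  rw [mem_smul_set_iff_inv_smul_mem₀ hs.ne', mem_ofPred_eq, mem_ofPred_eq,
    hhom _ _ (inv_pos.2 hs), inv_mul_le_iff₀ hs, mul_one]

lemma lintegral_Ioc_pow (k : ℕ) {b : ℝ} (hb : 0 ≤ b) :
    ∫⁻ r in Ioc 0 b, ENNReal.ofReal (r ^ k) = ENNReal.ofReal (b ^ (k + 1) / (k + 1)) := by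
  rw [← ofReal_integral_eq_lintegral_ofReal, ← intervalIntegral.integral_of_le hb, integral_pow,
    zero_pow k.succ_ne_zero, sub_zero]
  · exact (intervalIntegral.intervalIntegrable_pow _).1
  · filter_upwards [ae_restrict_mem measurableSet_Ioc] with r hr using pow_nonneg hr.1.le _

lemma lintegral_one_sub_of_homogeneous (hm : Measurable m) (hnonneg : ∀ y, 0 ≤ m y)
    (hhom : ∀ y, ∀ t : ℝ, 0 < t → m (t • y) = t * m y) :
    ((finrank ℝ F + 1 : ℕ) : ℝ≥0∞) * ∫⁻ y, ENNReal.ofReal (1 - m y) ∂μ = μ {y | m y ≤ 1} := by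
  have hslice : ∀ y, volume.restrict (Ioc (0 : ℝ) 1) (Ici (m y)) = ENNReal.ofReal (1 - m y) := by
    intro y
    rw [Measure.restrict_congr_set Ioc_ae_eq_Icc, Measure.restrict_apply measurableSet_Ici,
      ← Ici_inter_Iic, ← inter_assoc, Ici_inter_Ici, sup_eq_left.2 (hnonneg y), Ici_inter_Iic,
      Real.volume_Icc]
  have hregion : MeasurableSet {p : F × ℝ | m p.1 ≤ p.2} :=
    measurableSet_le (hm.comp measurable_fst) measurable_snd
  have htonelli : ∫⁻ y, ENNReal.ofReal (1 - m y) ∂μ = ∫⁻ t in Ioc (0 : ℝ) 1, μ {y | m y ≤ t} := by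
    simp only [← hslice]
    exact (Measure.prod_apply hregion).symm.trans (Measure.prod_apply_symm hregion)
  have hpow := lintegral_Ioc_pow (finrank ℝ F) zero_le_one
  rw [htonelli, setLIntegral_congr_fun measurableSet_Ioc fun t ht =>
      measure_sublevel_of_homogeneous μ hhom ht.1,
    lintegral_mul_const _ (by fun_prop), hpow, ← mul_assoc, ← ENNReal.ofReal_natCast,
    ← ENNReal.ofReal_mul (by positivity), one_pow, Nat.cast_add_one,
    mul_one_div_cancel (by positivity), ENNReal.ofReal_one, one_mul]

end LayerCake

/-! ### Sections and projections -/

section Sections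

variable {d : ℕ} {A : Set (E d)} {T : Submodule ℝ (E d)}

lemma tendsto_supportFun_cocompact (hA : IsCompact A) (h0 : 0 ∈ interior A) :
    Tendsto (supportFun A) (cocompact (E d)) atTop := by
  obtain ⟨r, hr, hle⟩ := exists_mul_norm_le_supportFun hA h0
  exact tendsto_atTop_mono hle (tendsto_norm_cocompact_atTop.const_mul_atTop hr)

lemma polarIn_inter_eq_image_starProjection (hA : IsCompact A) (hconv : Convex ℝ A)
    (h0 : 0 ∈ interior A) : polarIn T (A ∩ T) = T.starProjection '' polarBody A := by
  refine Subset.antisymm ?_ ?_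
  · rintro y ⟨hyT, hy⟩
    by_contra hnot_mem
    obtain ⟨z, hz, hyz⟩ := exists_mem_polarBody_one_lt_inner
      ((isCompact_polarBody hA h0).image T.starProjection.continuous).isClosed
      ((convex_polarBody A).is_linear_image T.starProjection.isBoundedLinearMap.toIsLinearMap)
      ⟨0, zero_mem_polarBody A, map_zero _⟩ hnot_mem
    have hprojA : T.starProjection z ∈ A := by
      rw [← polarBody_polarBody hA.isClosed hconv (interior_subset h0)]
      intro w hw
      rw [← T.inner_starProjection_left_eq_right]
      exact hz _ (mem_image_of_mem _ hw)
    have hle := hy _ ⟨hprojA, T.starProjection_apply_mem z⟩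
    rw [T.inner_starProjection_left_eq_right, Submodule.starProjection_eq_self_iff.2 hyT,
      real_inner_comm] at hle
    exact hyz.not_ge hle
  · rintro _ ⟨w, hw, rfl⟩
    refine ⟨T.starProjection_apply_mem w, fun x hx => ?_⟩
    rw [← T.inner_starProjection_left_eq_right, Submodule.starProjection_eq_self_iff.2 hx.2]
    exact hw x hx.1

lemma polarIn_inter_eq_image_val (hA : IsCompact A) (h0 : 0 ∈ A) :
    polarIn T (A ∩ T) = Subtype.val '' {y : T | supportFun (A ∩ T) y ≤ 1} := by
  ext y
  simp only [polarIn, mem_ofPred_eq, mem_image, Subtype.exists, exists_and_right, exists_eq_right,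
    supportFun_le_iff (hA.inter_right T.closed_of_finiteDimensional) ⟨0, h0, T.zero_mem⟩,
    exists_prop]

lemma supportFun_inter_le_add (hA : IsCompact A) (h0 : 0 ∈ A) (y : E d) {w : E d} (hw : w ∈ Tᗮ) :
    supportFun (A ∩ T) y ≤ supportFun A (y + w) := by
  rw [supportFun_le_iff (hA.inter_right T.closed_of_finiteDimensional) ⟨0, h0, T.zero_mem⟩]
  rintro a ⟨haA, haT⟩
  have hle := inner_le_supportFun hA haA (y + w)
  rwa [inner_add_right, Submodule.inner_right_of_mem_orthogonal haT hw, add_zero] at hle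

lemma supportFun_inter_pos (hA : IsCompact A) (h0 : 0 ∈ interior A) {y : E d} (hyT : y ∈ T)
    (hy : y ≠ 0) : 0 < supportFun (A ∩ T) y := by
  have hnear : ∀ᶠ t : ℝ in 𝓝[>] 0, t • y ∈ A := by
    have hcont : Tendsto (fun t : ℝ => t • y) (𝓝 0) (𝓝 0) := by
      simpa using (show Continuous fun t : ℝ => t • y by fun_prop).tendsto 0
    exact (hcont.eventually (mem_interior_iff_mem_nhds.1 h0)).filter_mono nhdsWithin_le_nhds
  obtain ⟨t, htA, ht⟩ := (hnear.and self_mem_nhdsWithin).exists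
  refine lt_of_lt_of_le ?_ (inner_le_supportFun (hA.inter_right T.closed_of_finiteDimensional)
    ⟨htA, T.smul_mem t hyT⟩ y)
  rw [real_inner_smul_left]
  exact mul_pos ht (real_inner_self_pos.2 hy)

lemma exists_supportFun_add_eq_supportFun_inter (hA : IsCompact A) (hconv : Convex ℝ A)
    (h0 : 0 ∈ interior A) {y : E d} (hyT : y ∈ T) :
    ∃ w ∈ Tᗮ, supportFun A (y + w) = supportFun (A ∩ T) y := by
  have h0A := interior_subset h0
  have hsection : IsCompact (A ∩ T) := hA.inter_right T.closed_of_finiteDimensional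
  rcases eq_or_ne y 0 with rfl | hy
  · exact ⟨0, zero_mem _, by
      rw [add_zero, supportFun_zero hA ⟨0, h0A⟩,
        supportFun_zero hsection ⟨0, h0A, T.zero_mem⟩]⟩
  set m := supportFun (A ∩ T) y
  have hm : 0 < m := supportFun_inter_pos hA h0 hyT hy
  have hpolar : m⁻¹ • y ∈ polarIn T (A ∩ T) := ⟨T.smul_mem _ hyT, fun a ha => by
    rw [real_inner_smul_right, inv_mul_le_one₀ hm]
    exact inner_le_supportFun hsection ha y⟩
  rw [polarIn_inter_eq_image_starProjection hA hconv h0] at hpolar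
  obtain ⟨z, hz, hzy⟩ := hpolar
  have hyz : y + m • (z - T.starProjection z) = m • z := by
    rw [hzy, smul_sub, smul_inv_smul₀ hm.ne', add_sub_cancel]
  have horth : m • (z - T.starProjection z) ∈ Tᗮ :=
    Tᗮ.smul_mem _ (T.sub_starProjection_mem_orthogonal z)
  refine ⟨_, horth, le_antisymm ?_ (supportFun_inter_le_add hA h0A y horth)⟩
  rw [polarBody_eq_supportFun_le_one hA ⟨0, h0A⟩] at hz
  rw [hyz, supportFun_smul hA ⟨0, h0A⟩ hm.le]
  exact mul_le_of_le_one_right hm.le hz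

lemma isLeast_range_supportFun_add_smul (hA : IsCompact A) (hconv : Convex ℝ A)
    (h0 : 0 ∈ interior A) {n : E d} (y : (ℝ ∙ n)ᗮ) :
    IsLeast (range fun t : ℝ => supportFun A (y + t • n)) (supportFun (A ∩ (ℝ ∙ n)ᗮ) y) := by
  constructor
  · obtain ⟨w, hw, hwy⟩ := exists_supportFun_add_eq_supportFun_inter hA hconv h0 y.2
    rw [Submodule.orthogonal_orthogonal] at hw
    obtain ⟨t, rfl⟩ := Submodule.mem_span_singleton.1 hw
    exact ⟨t, hwy⟩
  · rintro _ ⟨t, rfl⟩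
    refine supportFun_inter_le_add hA (interior_subset h0) _ ?_
    rw [Submodule.orthogonal_orthogonal]
    exact Submodule.smul_mem _ _ (Submodule.mem_span_singleton_self n)

/-- A form of Cauchy's projection formula: the left side is twice the shadow of `A°` along `n`. -/
lemma two_mul_area_polarIn_inter_orthogonal (hA : IsCompact A) (hconv : Convex ℝ A)
    (h0 : 0 ∈ interior A) {n : E d} (hn : ‖n‖ = 1) :
    2 * μHE[d - 1] (polarIn (ℝ ∙ n)ᗮ (A ∩ (ℝ ∙ n)ᗮ)) =
      d * ∫⁻ x in {x | supportFun A x ≤ 1}, ENNReal.ofReal |⟪gradient (supportFun A) x, n⟫| := by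
  have h0A := interior_subset h0
  have hsection : IsCompact (A ∩ (ℝ ∙ n)ᗮ) :=
    hA.inter_right (Submodule.closed_of_finiteDimensional _)
  have hsection_ne : (A ∩ (ℝ ∙ n)ᗮ).Nonempty := ⟨0, h0A, zero_mem _⟩
  have hrank : finrank ℝ (ℝ ∙ n)ᗮ + 1 = d := by
    rw [finrank_orthogonal_span_singleton_add_one (norm_ne_zero_iff.1 (hn ▸ one_ne_zero)),
      finrank_euclideanSpace_fin]
  have hcone := lintegral_one_sub_of_homogeneous (volume : Measure (ℝ ∙ n)ᗮ)
    (m := fun y => supportFun (A ∩ (ℝ ∙ n)ᗮ) y)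
    ((continuous_supportFun hsection hsection_ne).comp continuous_subtype_val).measurable
    (fun y => supportFun_nonneg hsection ⟨h0A, zero_mem _⟩ _)
    (fun y t ht => supportFun_smul hsection hsection_ne ht.le _)
  rw [hrank] at hcone
  rw [lintegral_abs_inner_gradient_sublevel (convexOn_supportFun hA ⟨0, h0A⟩)
      (ae_differentiableAt_supportFun hA ⟨0, h0A⟩) (tendsto_supportFun_cocompact hA h0) hn
      (isLeast_range_supportFun_add_smul hA hconv h0),
    polarIn_inter_eq_image_val hA h0A, Nat.sub_eq_of_eq_add hrank.symm,
    euclideanHausdorffMeasure_image_val, ← hcone]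
  simp only [ENNReal.ofReal_mul (zero_le_two (α := ℝ)), ENNReal.ofReal_ofNat]
  rw [lintegral_const_mul' _ _ ENNReal.ofNat_ne_top, mul_left_comm]

end Sections

/-! ### Polar coordinates -/

section Polar

variable {V : Type*} [NormedAddCommGroup V] [NormedSpace ℝ V]
  [MeasurableSpace V] [BorelSpace V] (μ : Measure V)

lemma ae_toSphere_of_ae {P : V → Prop} (hP : MeasurableSet {x | P x})
    (hcone : ∀ x, ∀ t : ℝ, 0 < t → P (t • x) → P x) (h : ∀ᵐ x ∂μ, P x) :
    ∀ᵐ θ : sphere (0 : V) 1 ∂μ.toSphere, P θ := by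
  have hexceptional : MeasurableSet {θ : sphere (0 : V) 1 | ¬P θ} :=
    (measurable_subtype_coe hP).compl
  rw [ae_iff, μ.toSphere_apply' hexceptional]
  refine mul_eq_zero_of_right _ (measure_mono_null ?_ (ae_iff.1 h))
  rintro _ ⟨t, ht, _, ⟨θ, hθ, rfl⟩, rfl⟩
  exact fun hmem => hθ (hcone _ _ ht.1 hmem)

variable [FiniteDimensional ℝ V] [Nontrivial V] [μ.IsAddHaarMeasure]

lemma lintegral_eq_lintegral_toSphere {f : V → ℝ≥0∞} (hf : Measurable f) :
    ∫⁻ x, f x ∂μ = ∫⁻ θ, (∫⁻ r in Ioi (0 : ℝ),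
      ENNReal.ofReal (r ^ (finrank ℝ V - 1)) * f (r • (θ : V))) ∂μ.toSphere := by
  have hpolar := μ.measurePreserving_homeomorphUnitSphereProd.symm
    (homeomorphUnitSphereProd V).toMeasurableEquiv
  calc ∫⁻ x, f x ∂μ = ∫⁻ x in ({0}ᶜ : Set V), f x ∂μ := by rw [restrict_compl_singleton]
    _ = ∫⁻ x : ({0}ᶜ : Set V), f x ∂(μ.comap Subtype.val) :=
        (lintegral_subtype_comap (measurableSet_singleton _).compl f).symm
    _ = ∫⁻ p, f (p.2.1 • (p.1 : V)) ∂(μ.toSphere.prod (.volumeIoiPow (finrank ℝ V - 1))) :=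
        (hpolar.lintegral_comp (hf.comp measurable_subtype_coe)).symm
    _ = ∫⁻ θ, ∫⁻ r, f (r.1 • (θ : V)) ∂.volumeIoiPow (finrank ℝ V - 1) ∂μ.toSphere :=
        lintegral_prod _ (hf.comp (by fun_prop)).aemeasurable
    _ = _ := lintegral_congr fun θ => by
        have hray : Measurable fun r : Ioi (0 : ℝ) => f (r.1 • (θ : V)) := hf.comp (by fun_prop)
        rw [Measure.volumeIoiPow, lintegral_withDensity_eq_lintegral_mul _ (by fun_prop) hray]
        exact lintegral_subtype_comap measurableSet_Ioi
          fun r : ℝ => ENNReal.ofReal (r ^ (finrank ℝ V - 1)) * f (r • (θ : V))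

lemma finrank_mul_setLIntegral_of_homogeneous {h : V → ℝ} (hh : Measurable h)
    (hhom : ∀ x, ∀ t : ℝ, 0 < t → h (t • x) = t * h x) (hpos : ∀ x ≠ 0, 0 < h x)
    {Q : V → ℝ≥0∞} (hQ : Measurable Q) (hQhom : ∀ x, ∀ t : ℝ, 0 < t → Q (t • x) = Q x) :
    finrank ℝ V * ∫⁻ x in {x | h x ≤ 1}, Q x ∂μ =
      ∫⁻ θ, Q θ * ENNReal.ofReal ((h θ ^ finrank ℝ V)⁻¹) ∂μ.toSphere := by
  obtain ⟨k, hk⟩ := Nat.exists_eq_add_one.2 (finrank_pos (R := ℝ) (M := V))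
  have hsublevel : MeasurableSet {x | h x ≤ 1} := measurableSet_le hh measurable_const
  have hray : ∀ θ : sphere (0 : V) 1, ∫⁻ r in Ioi (0 : ℝ),
      ENNReal.ofReal (r ^ k) * {x | h x ≤ 1}.indicator Q (r • (θ : V)) =
      ENNReal.ofReal ((h θ)⁻¹ ^ (k + 1) / (k + 1)) * Q θ := by
    intro θ
    have hθ : 0 < h θ := hpos _ (ne_zero_of_mem_unit_sphere θ)
    rw [← lintegral_Ioc_pow k (inv_pos.2 hθ).le, ← lintegral_mul_const _ (by fun_prop),
      ← Ioi_inter_Iic, inter_comm, ← Measure.restrict_restrict measurableSet_Iic,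
      ← lintegral_indicator measurableSet_Iic]
    refine setLIntegral_congr_fun measurableSet_Ioi fun r hr => ?_
    simp only [indicator, mem_ofPred_eq, mem_Iic, hhom _ _ hr, hQhom _ _ hr, ← one_div,
      le_div_iff₀ hθ, mul_ite, mul_zero]
  rw [← lintegral_indicator hsublevel,
    lintegral_eq_lintegral_toSphere μ (hQ.indicator hsublevel), hk, Nat.add_sub_cancel]
  simp only [hray]
  rw [← lintegral_const_mul' _ _ (ENNReal.natCast_ne_top _)]
  refine lintegral_congr fun θ => ?_
  rw [← mul_assoc, ← ENNReal.ofReal_natCast, ← ENNReal.ofReal_mul (by positivity),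
    Nat.cast_add_one, mul_div_cancel₀ _ (by positivity), inv_pow, mul_comm]

end Polar

/-! ### Measures that agree up to a factor -/

section WithinFactor

open scoped NNReal

/-- The two quantities `a` and `b` agree up to the factor `c`. Two measures are shown to be equal
by comparing them on small sets up to every factor larger than one. -/
def WithinFactor (c a b : ℝ≥0∞) : Prop := a ≤ c * b ∧ b ≤ c * a

namespace WithinFactor

variable {a b e c c' : ℝ≥0∞}

lemma symm (h : WithinFactor c a b) : WithinFactor c b a := ⟨h.2, h.1⟩

lemma trans (h : WithinFactor c a b) (h' : WithinFactor c' b e) : WithinFactor (c * c') a e :=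
  ⟨h.1.trans (by rw [mul_assoc]; gcongr; exact h'.1),
    h'.2.trans (by rw [mul_comm c, mul_assoc]; gcongr; exact h.2)⟩

lemma const_mul (h : WithinFactor c a b) (m : ℝ≥0∞) : WithinFactor c (m * a) (m * b) :=
  ⟨by rw [mul_left_comm]; gcongr; exact h.1, by rw [mul_left_comm]; gcongr; exact h.2⟩

lemma tsum {ι : Type*} {f g : ι → ℝ≥0∞} (h : ∀ i, WithinFactor c (f i) (g i)) :
    WithinFactor c (∑' i, f i) (∑' i, g i) := by
  simp only [WithinFactor, ← ENNReal.tsum_mul_left]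
  exact ⟨ENNReal.tsum_le_tsum fun i => (h i).1, ENNReal.tsum_le_tsum fun i => (h i).2⟩

end WithinFactor

lemma le_of_forall_one_lt_le_pow_mul {a b : ℝ≥0∞} {k : ℕ}
    (h : ∀ c : ℝ≥0, 1 < c → a ≤ (c : ℝ≥0∞) ^ k * b) : a ≤ b := by
  have hlim : Tendsto (fun c : ℝ≥0 => (c : ℝ≥0∞) ^ k * b) (𝓝[>] 1)
      (𝓝 (((1 : ℝ≥0) : ℝ≥0∞) ^ k * b)) :=
    (ENNReal.Tendsto.mul_const (((ENNReal.continuous_pow k).comp ENNReal.continuous_coe).tendsto 1)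
      (Or.inl (by simp))).mono_left nhdsWithin_le_nhds
  rw [ENNReal.coe_one, one_pow, one_mul] at hlim
  exact ge_of_tendsto hlim (by filter_upwards [self_mem_nhdsWithin] with c hc using h c hc)

lemma eq_of_forall_one_lt_withinFactor_pow {a b : ℝ≥0∞} {k : ℕ}
    (h : ∀ c : ℝ≥0, 1 < c → WithinFactor ((c : ℝ≥0∞) ^ k) a b) : a = b :=
  (le_of_forall_one_lt_le_pow_mul fun c hc => (h c hc).1).antisymm
    (le_of_forall_one_lt_le_pow_mul fun c hc => (h c hc).2)

lemma withinFactor_setLIntegral_const {X : Type*} [MeasurableSpace X] {ν : Measure X} {B : Set X}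
    (hB : MeasurableSet B) {f : X → ℝ≥0∞} {a : ℝ≥0∞} {c : ℝ≥0}
    (h : ∀ x ∈ B, WithinFactor c (f x) a) : WithinFactor c (∫⁻ x in B, f x ∂ν) (a * ν B) := by
  rw [← setLIntegral_const, WithinFactor, ← lintegral_const_mul' _ _ ENNReal.coe_ne_top,
    ← lintegral_const_mul' _ _ ENNReal.coe_ne_top]
  exact ⟨setLIntegral_mono' hB fun x hx => (h x hx).1,
    setLIntegral_mono' hB fun x hx => (h x hx).2⟩

lemma exists_measurable_partition_dist_le {X Y : Type*} [MeasurableSpace X] [MetricSpace Y]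
    [TopologicalSpace.SeparableSpace Y] [Nonempty Y] [MeasurableSpace Y] [BorelSpace Y]
    {f : X → Y} (hf : Measurable f) {δ : ℝ} (hδ : 0 < δ) :
    ∃ U : ℕ → Set X, (∀ n, MeasurableSet (U n)) ∧ Pairwise (Function.onFun Disjoint U) ∧
      ⋃ n, U n = univ ∧ ∀ n, ∀ x ∈ U n, ∀ y ∈ U n, dist (f x) (f y) ≤ δ := by
  set W : ℕ → Set X := fun n => f ⁻¹' ball (TopologicalSpace.denseSeq Y n) (δ / 2)
  refine ⟨disjointed W, fun n => .disjointed (fun n => hf measurableSet_ball) n,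
    disjoint_disjointed W, ?_, fun n x hx y hy => ?_⟩
  · rw [iUnion_disjointed, eq_univ_iff_forall]
    intro x
    obtain ⟨n, hn⟩ := (TopologicalSpace.denseRange_denseSeq Y).exists_dist_lt (f x) (half_pos hδ)
    exact mem_iUnion.2 ⟨n, hn⟩
  · have hx' : dist (f x) _ < δ / 2 := disjointed_subset W n hx
    have hy' : dist (f y) _ < δ / 2 := disjointed_subset W n hy
    linarith [dist_triangle_right (f x) (f y) (TopologicalSpace.denseSeq Y n)]

lemma withinFactor_measure_of_locally {X Y : Type*} [MeasurableSpace X] [MetricSpace Y]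
    [TopologicalSpace.SeparableSpace Y] [Nonempty Y] [MeasurableSpace Y] [BorelSpace Y]
    {μ ν : Measure X} {f : X → Y} (hf : Measurable f) {S : Set X} {c : ℝ≥0∞} {δ : ℝ} (hδ : 0 < δ)
    (hlocal : ∀ B ⊆ S, MeasurableSet B → (∀ x ∈ B, ∀ y ∈ B, dist (f x) (f y) ≤ δ) →
      WithinFactor c (μ B) (ν B)) {B : Set X} (hBS : B ⊆ S) (hB : MeasurableSet B) :
    WithinFactor c (μ B) (ν B) := by
  obtain ⟨U, hU, hdisj, hcover, hdist⟩ := exists_measurable_partition_dist_le hf hδ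
  have hsum : ∀ m : Measure X, m B = ∑' n, m (B ∩ U n) := fun m => by
    rw [← measure_iUnion (fun i j hij => (hdisj hij).mono inter_subset_right inter_subset_right)
      fun n => hB.inter (hU n), ← inter_iUnion, hcover, inter_univ]
  rw [hsum μ, hsum ν]
  exact .tsum fun n => hlocal _ (inter_subset_left.trans hBS) (hB.inter (hU n))
    fun x hx y hy => hdist n x hx.2 y hy.2

lemma withinFactor_euclideanHausdorffMeasure_image {X Y : Type*} [EMetricSpace X]
    [MeasurableSpace X] [BorelSpace X] [EMetricSpace Y] [MeasurableSpace Y] [BorelSpace Y]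
    {f : X → Y} {s : Set X} {c : ℝ≥0} (hlip : LipschitzWith c (s.domRestrict f))
    (hanti : AntilipschitzWith c (s.domRestrict f)) (k : ℕ) :
    WithinFactor ((c : ℝ≥0∞) ^ k) (μHE[k] (f '' s)) (μHE[k] s) := by
  have himage := hlip.hausdorffMeasure_image_le k.cast_nonneg univ
  have hpreimage := hanti.le_hausdorffMeasure_image k.cast_nonneg univ
  have hsource : μHE[k] s = (μHE[k] : Measure s) univ := by
    rw [← (isometry_subtype_coe (s := s)).euclideanHausdorffMeasure_image, image_univ,
      Subtype.range_coe]
  rw [image_univ, range_domRestrict, ENNReal.rpow_natCast] at himage hpreimage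
  rw [hsource, Measure.euclideanHausdorffMeasure_def, Measure.euclideanHausdorffMeasure_def]
  simp only [Measure.smul_apply, ENNReal.smul_def, smul_eq_mul]
  exact WithinFactor.const_mul ⟨himage, hpreimage⟩ _

end WithinFactor

/-! ### Cones over nearly flat sets -/

section Cone

open scoped NNReal

lemma mem_Ioc_zero_one_smul_iff {M : Type*} [AddCommGroup M] [Module ℝ M] {h : M → ℝ}
    (hhom : ∀ x, ∀ t : ℝ, 0 < t → h (t • x) = t * h x) {B : Set M} (hB : ∀ x ∈ B, h x = 1)
    {z : M} : z ∈ Ioc (0 : ℝ) 1 • B ↔ h z ∈ Ioc 0 1 ∧ (h z)⁻¹ • z ∈ B := by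
  constructor
  · rintro ⟨t, ht, x, hx, rfl⟩
    have hval : h (t • x) = t := by rw [hhom x t ht.1, hB x hx, mul_one]
    simpa only [hval, inv_smul_smul₀ ht.1.ne'] using And.intro ht hx
  · rintro ⟨hz, hzB⟩
    exact ⟨_, hz, _, hzB, smul_inv_smul₀ hz.1.ne' z⟩

lemma addHaar_cone_le_pow_mul {M : Type*} [NormedAddCommGroup M] [NormedSpace ℝ M]
    [MeasurableSpace M] [BorelSpace M] [FiniteDimensional ℝ M] (μ : Measure M)
    [μ.IsAddHaarMeasure] {c : ℝ≥0} {X Y : Set M} (hXY : X ⊆ Ioc (0 : ℝ) c • Y) :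
    μ (Ioc (0 : ℝ) 1 • X) ≤ (c : ℝ≥0∞) ^ finrank ℝ M * μ (Ioc (0 : ℝ) 1 • Y) := by
  have hscale : μ ((c : ℝ) • Ioc (0 : ℝ) 1 • Y) =
      (c : ℝ≥0∞) ^ finrank ℝ M * μ (Ioc (0 : ℝ) 1 • Y) := by
    rw [Measure.addHaar_smul_of_nonneg _ c.coe_nonneg, ENNReal.ofReal_pow c.coe_nonneg,
      ENNReal.ofReal_coe_nnreal]
  rw [← hscale]
  refine measure_mono ?_
  rintro _ ⟨t, ht, x, hx, rfl⟩
  obtain ⟨s, hs, y, hy, rfl⟩ := hXY hx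
  have hc : (0 : ℝ) < c := hs.1.trans_le hs.2
  refine ⟨_, ⟨t * s / c, ⟨by have := ht.1; have := hs.1; positivity, ?_⟩, y, hy, rfl⟩, ?_⟩
  · rw [div_le_one hc]
    exact (mul_le_of_le_one_left hs.1.le ht.2).trans hs.2
  · simp only [smul_smul, mul_div_cancel₀ _ hc.ne']

variable {V : Type*} [NormedAddCommGroup V] [InnerProductSpace ℝ V]

lemma mem_Ioc_zero_one_smul_iff_of_subset_hyperplane {n : V} {a : ℝ} (ha : a ≠ 0) {B : Set V}
    (hB : ∀ x ∈ B, ⟪n, x⟫ = a) {z : V} : z ∈ Ioc (0 : ℝ) 1 • B ↔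
      a⁻¹ * ⟪n, z⟫ ∈ Ioc 0 1 ∧ (a⁻¹ * ⟪n, z⟫)⁻¹ • z ∈ B :=
  mem_Ioc_zero_one_smul_iff (h := fun z => a⁻¹ * ⟪n, z⟫)
    (fun x t _ => by rw [real_inner_smul_right, mul_left_comm])
    fun x hx => by rw [hB x hx, inv_mul_cancel₀ ha]

variable [FiniteDimensional ℝ V] [MeasurableSpace V] [BorelSpace V]

lemma euclideanHausdorffMeasure_eq_volume_of_subset_hyperplane {n : V} (hn : ‖n‖ = 1) {a : ℝ}
    {B : Set V} (hB : ∀ x ∈ B, ⟪n, x⟫ = a) :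
    μHE[finrank ℝ (ℝ ∙ n)ᗮ] B = volume {y : (ℝ ∙ n)ᗮ | (y : V) + a • n ∈ B} := by
  have himage : (fun x => x + a • n) '' (Subtype.val '' {y : (ℝ ∙ n)ᗮ | (y : V) + a • n ∈ B}) =
      B := by
    ext x
    constructor
    · rintro ⟨_, ⟨y, hy, rfl⟩, rfl⟩
      exact hy
    · intro hx
      have hperp : x - a • n ∈ (ℝ ∙ n)ᗮ := by
        rw [Submodule.mem_orthogonal_singleton_iff_inner_right, inner_sub_right,
          real_inner_smul_right, real_inner_self_eq_norm_sq, hB x hx, hn]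
        ring
      exact ⟨x - a • n, ⟨⟨_, hperp⟩, by simpa using hx, rfl⟩, by simp⟩
  have hisom : Isometry fun x : V => x + a • n :=
    Isometry.of_dist_eq fun x y => dist_add_right x y (a • n)
  conv_lhs => rw [← himage]
  rw [hisom.euclideanHausdorffMeasure_image, euclideanHausdorffMeasure_image_val]

lemma volume_slice_cone_of_subset_hyperplane {n : V} (hn : ‖n‖ = 1) {a : ℝ} (ha : 0 < a)
    {B : Set V} (hB : ∀ x ∈ B, ⟪n, x⟫ = a) (t : ℝ) :
    volume {y : (ℝ ∙ n)ᗮ | (y : V) + t • n ∈ Ioc (0 : ℝ) 1 • B} =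
      (Ioc 0 a).indicator (fun t => ENNReal.ofReal ((t / a) ^ finrank ℝ (ℝ ∙ n)ᗮ) *
        volume {y : (ℝ ∙ n)ᗮ | (y : V) + a • n ∈ B}) t := by
  have hheight : ∀ y : (ℝ ∙ n)ᗮ, a⁻¹ * ⟪n, (y : V) + t • n⟫ = t / a := fun y => by
    rw [inner_add_right, Submodule.mem_orthogonal_singleton_iff_inner_right.1 y.2,
      real_inner_smul_right, real_inner_self_eq_norm_sq, hn]
    ring
  have hIoc : t / a ∈ Ioc (0 : ℝ) 1 ↔ t ∈ Ioc 0 a := by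
    rw [mem_Ioc, mem_Ioc, div_le_one ha, div_pos_iff_of_pos_right ha]
  simp only [mem_Ioc_zero_one_smul_iff_of_subset_hyperplane ha.ne' hB, hheight, hIoc]
  by_cases ht : t ∈ Ioc 0 a
  · have hta : 0 < t / a := div_pos ht.1 ha
    rw [indicator_of_mem ht, ← Measure.addHaar_smul_of_nonneg _ hta.le]
    congr 1
    ext y
    rw [mem_smul_set_iff_inv_smul_mem₀ hta.ne', mem_ofPred_eq, mem_ofPred_eq, smul_add, smul_smul,
      inv_div, div_mul_cancel₀ _ ht.1.ne']
    simp only [ht, true_and, Submodule.coe_smul]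
  · simp [ht]

lemma finrank_mul_volume_cone_of_subset_hyperplane {n : V} (hn : ‖n‖ = 1) {a : ℝ} (ha : 0 < a)
    {B : Set V} (hBmeas : MeasurableSet B) (hB : ∀ x ∈ B, ⟪n, x⟫ = a) :
    finrank ℝ V * volume (Ioc (0 : ℝ) 1 • B) =
      ENNReal.ofReal a * μHE[finrank ℝ V - 1] B := by
  have hn0 : n ≠ 0 := norm_ne_zero_iff.1 (by rw [hn]; exact one_ne_zero)
  have hcone : MeasurableSet (Ioc (0 : ℝ) 1 • B) := by
    have hlevel : Measurable fun z : V => a⁻¹ * ⟪n, z⟫ := Continuous.measurable (by fun_prop)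
    rw [Set.ext fun z => mem_Ioc_zero_one_smul_iff_of_subset_hyperplane ha.ne' hB]
    exact (hlevel measurableSet_Ioc).inter ((hlevel.inv.smul measurable_id) hBmeas)
  have hpow : ∀ k : ℕ, ((k + 1 : ℕ) : ℝ≥0∞) * ∫⁻ t in Ioc 0 a, ENNReal.ofReal ((t / a) ^ k) =
      ENNReal.ofReal a := fun k => by
    simp only [div_pow, div_eq_inv_mul _ (a ^ k), ENNReal.ofReal_mul (inv_pos.2 (pow_pos ha k)).le]
    rw [lintegral_const_mul' _ _ ENNReal.ofReal_ne_top, lintegral_Ioc_pow k ha.le,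
      ← ENNReal.ofReal_mul (by positivity), ← ENNReal.ofReal_natCast,
      ← ENNReal.ofReal_mul (by positivity)]
    congr 1
    push_cast
    field_simp
    ring
  have hmp := measurePreserving_add_smul hn
  rw [← hmp.measure_preimage hcone.nullMeasurableSet,
    Measure.prod_apply_symm (hmp.measurable hcone)]
  simp only [preimage, mem_ofPred_eq, volume_slice_cone_of_subset_hyperplane hn ha hB]
  rw [lintegral_indicator measurableSet_Ioc, lintegral_mul_const _ (by fun_prop), ← mul_assoc,
    ← finrank_orthogonal_span_singleton_add_one hn0, hpow, Nat.add_sub_cancel,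
    euclideanHausdorffMeasure_eq_volume_of_subset_hyperplane hn hB]

end Cone

section NearlyFlat

open scoped NNReal

variable {V : Type*} [NormedAddCommGroup V] [InnerProductSpace ℝ V]

/-- Central projection from the origin to the hyperplane `{x | ⟪p, x⟫ = 1}`. -/
noncomputable def centralProjection (p x : V) : V := ⟪p, x⟫⁻¹ • x

/-- The set `B` lies within `η` of the hyperplane `{x | ⟪p, x⟫ = 1}`, and its chords, weighted by
the distance of their endpoints from the origin, have slope at most `η` with respect to it. Central
projection to the hyperplane then distorts `B` little. -/
structure NearlyFlat (η : ℝ) (p : V) (B : Set V) : Prop where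
  abs_inner_sub_one_le : ∀ x ∈ B, |⟪p, x⟫ - 1| ≤ η
  abs_inner_sub_mul_norm_le : ∀ x ∈ B, ∀ y ∈ B, |⟪p, x - y⟫| * ‖y‖ ≤ η * ‖x - y‖

lemma two_sub_inv_le {c : ℝ} (hc : 0 < c) : 2 - c⁻¹ ≤ c := by
  have hcancel : c * c⁻¹ = 1 := mul_inv_cancel₀ hc.ne'
  have := inv_pos.2 hc
  nlinarith [sq_nonneg (c - 1)]

namespace NearlyFlat

variable {η : ℝ} {p : V} {B : Set V} {c : ℝ≥0}

lemma inner_mem_Icc (hB : NearlyFlat η p B) {x : V} (hx : x ∈ B) :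
    ⟪p, x⟫ ∈ Icc (1 - η) (1 + η) := by
  have h := abs_le.1 (hB.abs_inner_sub_one_le x hx)
  constructor <;> linarith [h.1, h.2]

lemma norm_centralProjection_sub_sub_le (hB : NearlyFlat η p B) (hη : η ≤ 1 / 4) {x y : V}
    (hx : x ∈ B) (hy : y ∈ B) :
    ‖centralProjection p x - centralProjection p y - (x - y)‖ ≤ 4 * η * ‖x - y‖ := by
  have hxinner : 3 / 4 ≤ ⟪p, x⟫ := by linarith [(hB.inner_mem_Icc hx).1]
  have hyinner : 3 / 4 ≤ ⟪p, y⟫ := by linarith [(hB.inner_mem_Icc hy).1]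
  have hxpos : 0 < ⟪p, x⟫ := by linarith
  have hypos : 0 < ⟪p, y⟫ := by linarith
  have hη0 : 0 ≤ η := (abs_nonneg _).trans (hB.abs_inner_sub_one_le x hx)
  have hscaling : |⟪p, x⟫⁻¹ - 1| ≤ 4 / 3 * η := by
    rw [show ⟪p, x⟫⁻¹ - 1 = -(⟪p, x⟫ - 1) / ⟪p, x⟫ by field_simp; ring, abs_div, abs_neg,
      abs_of_pos hxpos, div_le_iff₀ hxpos]
    nlinarith [hB.abs_inner_sub_one_le x hx]
  have hdrift : |⟪p, x⟫⁻¹ - ⟪p, y⟫⁻¹| * ‖y‖ ≤ 16 / 9 * (η * ‖x - y‖) := by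
    rw [show ⟪p, x⟫⁻¹ - ⟪p, y⟫⁻¹ = -⟪p, x - y⟫ / (⟪p, x⟫ * ⟪p, y⟫) by
        rw [inner_sub_right]; field_simp; ring,
      abs_div, abs_neg, abs_of_pos (mul_pos hxpos hypos), div_mul_eq_mul_div,
      div_le_iff₀ (by positivity)]
    have hprod : 9 / 16 ≤ ⟪p, x⟫ * ⟪p, y⟫ := by nlinarith
    have hnonneg : 0 ≤ η * ‖x - y‖ := by positivity
    nlinarith [hB.abs_inner_sub_mul_norm_le x hx y hy]
  calc ‖centralProjection p x - centralProjection p y - (x - y)‖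
      = ‖(⟪p, x⟫⁻¹ - 1) • (x - y) + (⟪p, x⟫⁻¹ - ⟪p, y⟫⁻¹) • y‖ := by
        rw [centralProjection, centralProjection]
        congr 1
        module
    _ ≤ |⟪p, x⟫⁻¹ - 1| * ‖x - y‖ + |⟪p, x⟫⁻¹ - ⟪p, y⟫⁻¹| * ‖y‖ := by
        simpa only [norm_smul, Real.norm_eq_abs] using norm_add_le
          ((⟪p, x⟫⁻¹ - 1) • (x - y)) ((⟪p, x⟫⁻¹ - ⟪p, y⟫⁻¹) • y)
    _ ≤ 4 / 3 * η * ‖x - y‖ + 16 / 9 * (η * ‖x - y‖) := by gcongr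
    _ ≤ 4 * η * ‖x - y‖ := by nlinarith [mul_nonneg hη0 (norm_nonneg (x - y))]

lemma le_one_fourth (hc : 0 < c) (hη : 4 * η ≤ 1 - (c : ℝ)⁻¹) : η ≤ 1 / 4 := by
  have := inv_pos.2 (NNReal.coe_pos.2 hc)
  linarith

lemma lipschitzWith_centralProjection (hB : NearlyFlat η p B) (hc : 0 < c)
    (hη : 4 * η ≤ 1 - (c : ℝ)⁻¹) : LipschitzWith c (B.domRestrict (centralProjection p)) := by
  refine LipschitzWith.of_dist_le_mul fun x y => ?_
  have hfactor : 1 + 4 * η ≤ c := by linarith [two_sub_inv_le (NNReal.coe_pos.2 hc)]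
  have hdist := hB.norm_centralProjection_sub_sub_le (le_one_fourth hc hη) x.2 y.2
  have htriangle := norm_le_norm_add_norm_sub' (centralProjection p (x : V) - centralProjection p y)
    ((x : V) - y)
  rw [Subtype.dist_eq, dist_eq_norm, dist_eq_norm]
  calc ‖centralProjection p (x : V) - centralProjection p y‖
      ≤ (1 + 4 * η) * ‖(x : V) - y‖ := by linarith
    _ ≤ c * ‖(x : V) - y‖ := by gcongr

lemma antilipschitzWith_centralProjection (hB : NearlyFlat η p B) (hc : 0 < c)
    (hη : 4 * η ≤ 1 - (c : ℝ)⁻¹) : AntilipschitzWith c (B.domRestrict (centralProjection p)) := by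
  refine AntilipschitzWith.of_le_mul_dist fun x y => ?_
  have hc' : (0 : ℝ) < c := NNReal.coe_pos.2 hc
  have hdist := hB.norm_centralProjection_sub_sub_le (le_one_fourth hc hη) x.2 y.2
  have htriangle := norm_le_norm_add_norm_sub (centralProjection p (x : V) - centralProjection p y)
    ((x : V) - y)
  rw [Subtype.dist_eq, dist_eq_norm, dist_eq_norm, ← inv_mul_le_iff₀ hc']
  calc (c : ℝ)⁻¹ * ‖(x : V) - y‖ ≤ (1 - 4 * η) * ‖(x : V) - y‖ := by gcongr; linarith
    _ ≤ ‖centralProjection p (x : V) - centralProjection p y‖ := by linarith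

lemma withinFactor_euclideanHausdorffMeasure [MeasurableSpace V] [BorelSpace V]
    (hB : NearlyFlat η p B) (hc : 0 < c) (hη : 4 * η ≤ 1 - (c : ℝ)⁻¹) (k : ℕ) :
    WithinFactor ((c : ℝ≥0∞) ^ k) (μHE[k] (centralProjection p '' B)) (μHE[k] B) :=
  withinFactor_euclideanHausdorffMeasure_image (hB.lipschitzWith_centralProjection hc hη)
    (hB.antilipschitzWith_centralProjection hc hη) k

variable [FiniteDimensional ℝ V] [MeasurableSpace V] [BorelSpace V]

lemma withinFactor_addHaar_cone (hB : NearlyFlat η p B) (hc : 0 < c)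
    (hη : 4 * η ≤ 1 - (c : ℝ)⁻¹) (μ : Measure V) [μ.IsAddHaarMeasure] :
    WithinFactor ((c : ℝ≥0∞) ^ finrank ℝ V) (μ (Ioc (0 : ℝ) 1 • B))
      (μ (Ioc (0 : ℝ) 1 • (centralProjection p '' B))) := by
  have hc' : (0 : ℝ) < c := NNReal.coe_pos.2 hc
  have hη' := le_one_fourth hc hη
  constructor <;> refine addHaar_cone_le_pow_mul μ ?_
  · intro x hx
    have hinner := hB.inner_mem_Icc hx
    have hpos : 0 < ⟪p, x⟫ := by linarith [hinner.1]
    have hle : ⟪p, x⟫ ≤ c := by linarith [hinner.1, hinner.2, two_sub_inv_le hc']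
    exact ⟨_, ⟨hpos, hle⟩, _, mem_image_of_mem _ hx, smul_inv_smul₀ hpos.ne' x⟩
  · rintro _ ⟨x, hx, rfl⟩
    have hinner := hB.inner_mem_Icc hx
    have hpos : 0 < ⟪p, x⟫ := by linarith [hinner.1]
    have hle : ⟪p, x⟫⁻¹ ≤ c := inv_le_of_inv_le₀ hc' (by linarith [hinner.1, hinner.2])
    exact ⟨_, ⟨inv_pos.2 hpos, hle⟩, x, hx, rfl⟩

lemma measurableSet_image_centralProjection (hB : NearlyFlat η p B) (hc : 0 < c)
    (hη : 4 * η ≤ 1 - (c : ℝ)⁻¹) (hBmeas : MeasurableSet B) :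
    MeasurableSet (centralProjection p '' B) := by
  have : CompleteSpace V := FiniteDimensional.complete ℝ V
  have hmeas : Measurable (centralProjection p) := by
    have hinner : Measurable fun x : V => ⟪p, x⟫ := Continuous.measurable (by fun_prop)
    exact hinner.inv.smul measurable_id
  exact hBmeas.image_of_measurable_injOn hmeas
    (injOn_iff_injective.2 (hB.antilipschitzWith_centralProjection hc hη).injective)

lemma withinFactor_finrank_mul_volume_cone (hB : NearlyFlat η p B) (hc : 0 < c)
    (hη : 4 * η ≤ 1 - (c : ℝ)⁻¹) (hp : p ≠ 0) (hBmeas : MeasurableSet B) :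
    WithinFactor ((c : ℝ≥0∞) ^ finrank ℝ V * (c : ℝ≥0∞) ^ (finrank ℝ V - 1))
      (finrank ℝ V * volume (Ioc (0 : ℝ) 1 • B))
      (ENNReal.ofReal ‖p‖⁻¹ * μHE[finrank ℝ V - 1] B) := by
  have hflat : ∀ x ∈ centralProjection p '' B, ⟪‖p‖⁻¹ • p, x⟫ = ‖p‖⁻¹ := by
    rintro _ ⟨x, hx, rfl⟩
    have hpos : 0 < ⟪p, x⟫ := by linarith [(hB.inner_mem_Icc hx).1, le_one_fourth hc hη]
    rw [centralProjection, real_inner_smul_left, real_inner_smul_right, inv_mul_cancel₀ hpos.ne',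
      mul_one]
  have hcone := finrank_mul_volume_cone_of_subset_hyperplane (norm_smul_inv_norm hp)
    (inv_pos.2 (norm_pos_iff.2 hp)) (hB.measurableSet_image_centralProjection hc hη hBmeas) hflat
  refine ((hB.withinFactor_addHaar_cone hc hη volume).const_mul _).trans ?_
  rw [hcone]
  exact (hB.withinFactor_euclideanHausdorffMeasure hc hη _).const_mul _

end NearlyFlat

end NearlyFlat

/-! ### The cone measure of a level surface -/

section ConeMeasure

open scoped NNReal

variable {V : Type*} [NormedAddCommGroup V] [InnerProductSpace ℝ V] {P : Set V}

section Gradient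

variable [CompleteSpace V]

lemma inner_gradient_sub_nonpos (hP : IsCompact P) (hne : P.Nonempty) {x y : V}
    (hx : x ∈ smoothLevel P) (hy : y ∈ smoothLevel P) :
    ⟪gradient (supportFun P) x, y - x⟫ ≤ 0 := by
  rw [inner_sub_right, inner_gradient_of_mem_smoothLevel hP hne hx, sub_nonpos, ← hy.1]
  exact inner_le_supportFun hP (gradient_supportFun_mem hP hne hx.2) y

lemma inner_sub_le_of_norm_sub_gradient_le (hP : IsCompact P) (hne : P.Nonempty) {x y p : V}
    (hx : x ∈ smoothLevel P) (hy : y ∈ smoothLevel P) {δ : ℝ}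
    (hpx : ‖p - gradient (supportFun P) x‖ ≤ δ) : ⟪p, y - x⟫ ≤ δ * ‖y - x‖ := by
  have hnonpos := inner_gradient_sub_nonpos hP hne hx hy
  have hdiff := (real_inner_le_norm (p - gradient (supportFun P) x) (y - x)).trans
    (mul_le_mul_of_nonneg_right hpx (norm_nonneg _))
  rw [inner_sub_left] at hdiff
  linarith

lemma abs_inner_sub_le_of_norm_sub_gradient_le (hP : IsCompact P) (hne : P.Nonempty) {x y p : V}
    (hx : x ∈ smoothLevel P) (hy : y ∈ smoothLevel P) {δ : ℝ}
    (hpx : ‖p - gradient (supportFun P) x‖ ≤ δ) (hpy : ‖p - gradient (supportFun P) y‖ ≤ δ) :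
    |⟪p, x - y⟫| ≤ δ * ‖x - y‖ := by
  refine abs_le'.2 ⟨inner_sub_le_of_norm_sub_gradient_le hP hne hy hx hpy, ?_⟩
  rw [← inner_neg_right, neg_sub, norm_sub_rev]
  exact inner_sub_le_of_norm_sub_gradient_le hP hne hx hy hpx

lemma nearlyFlat_of_dist_gradient_le (hP : IsCompact P) (hne : P.Nonempty) {B : Set V}
    (hBP : B ⊆ smoothLevel P) {δ R η : ℝ} (hR : ∀ x ∈ B, ‖x‖ ≤ R) (hη : 2 * R * δ ≤ η)
    (hδ : ∀ x ∈ B, ∀ y ∈ B, dist (gradient (supportFun P) x) (gradient (supportFun P) y) ≤ δ)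
    {x₀ : V} (hx₀ : x₀ ∈ B) : NearlyFlat η (gradient (supportFun P) x₀) B := by
  have hδ0 : 0 ≤ δ := dist_nonneg.trans (hδ x₀ hx₀ x₀ hx₀)
  have hR0 : 0 ≤ R := (norm_nonneg x₀).trans (hR x₀ hx₀)
  have hchord : ∀ x ∈ B, ∀ y ∈ B, |⟪gradient (supportFun P) x₀, x - y⟫| ≤ δ * ‖x - y‖ :=
    fun x hx y hy => abs_inner_sub_le_of_norm_sub_gradient_le hP hne (hBP hx) (hBP hy)
      ((dist_eq_norm _ _).symm.trans_le (hδ x₀ hx₀ x hx))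
      ((dist_eq_norm _ _).symm.trans_le (hδ x₀ hx₀ y hy))
  constructor
  · intro x hx
    have hdiam : ‖x - x₀‖ ≤ 2 * R := by linarith [norm_sub_le x x₀, hR x hx, hR x₀ hx₀]
    rw [← inner_gradient_of_mem_smoothLevel hP hne (hBP hx₀), ← inner_sub_right]
    calc _ ≤ δ * ‖x - x₀‖ := hchord x hx x₀ hx₀
      _ ≤ δ * (2 * R) := by gcongr
      _ ≤ η := by linarith
  · intro x hx y hy
    have hδR : δ * R ≤ η := by nlinarith
    calc _ ≤ δ * ‖x - y‖ * R := mul_le_mul (hchord x hx y hy) (hR y hy) (norm_nonneg _)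
          (by positivity)
      _ = δ * R * ‖x - y‖ := by ring
      _ ≤ η * ‖x - y‖ := by gcongr

lemma norm_gradient_le_mul_norm_gradient (hP : IsCompact P) (hne : P.Nonempty) {x y : V}
    (hx : x ∈ smoothLevel P) {δ R c : ℝ} (hxR : ‖x‖ ≤ R)
    (hδ : dist (gradient (supportFun P) y) (gradient (supportFun P) x) ≤ δ)
    (hc : R * δ ≤ c - 1) : ‖gradient (supportFun P) y‖ ≤ c * ‖gradient (supportFun P) x‖ := by
  have hδ0 : 0 ≤ δ := dist_nonneg.trans hδ
  have hone : 1 ≤ ‖gradient (supportFun P) x‖ * R := by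
    rw [← inner_gradient_of_mem_smoothLevel hP hne hx]
    exact (real_inner_le_norm _ _).trans (by gcongr)
  have htriangle := norm_le_norm_add_norm_sub' (gradient (supportFun P) y)
    (gradient (supportFun P) x)
  rw [← dist_eq_norm] at htriangle
  have hnonneg := norm_nonneg (gradient (supportFun P) x)
  nlinarith

lemma withinFactor_inv_norm_gradient (hP : IsCompact P) (hne : P.Nonempty) {x y : V}
    (hx : x ∈ smoothLevel P) (hy : y ∈ smoothLevel P) {δ R : ℝ} {c : ℝ≥0} (hxR : ‖x‖ ≤ R)
    (hyR : ‖y‖ ≤ R) (hδ : dist (gradient (supportFun P) x) (gradient (supportFun P) y) ≤ δ)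
    (hc : R * δ ≤ c - 1) :
    WithinFactor c (ENNReal.ofReal ‖gradient (supportFun P) x‖⁻¹)
      (ENNReal.ofReal ‖gradient (supportFun P) y‖⁻¹) := by
  have hle : ∀ a b : ℝ, 0 < a → 0 < b → b ≤ c * a →
      ENNReal.ofReal a⁻¹ ≤ c * ENNReal.ofReal b⁻¹ := fun a b ha hb hab => by
    rw [← ENNReal.ofReal_coe_nnreal, ← ENNReal.ofReal_mul c.coe_nonneg]
    refine ENNReal.ofReal_le_ofReal ?_
    rwa [inv_le_iff_one_le_mul₀ ha, mul_right_comm, ← div_eq_mul_inv, one_le_div hb]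
  have hxpos := norm_pos_iff.2 (gradient_ne_zero_of_mem_smoothLevel hP hne hx)
  have hypos := norm_pos_iff.2 (gradient_ne_zero_of_mem_smoothLevel hP hne hy)
  exact ⟨hle _ _ hxpos hypos (norm_gradient_le_mul_norm_gradient hP hne hx hxR
      ((dist_comm _ _).trans_le hδ) hc),
    hle _ _ hypos hxpos (norm_gradient_le_mul_norm_gradient hP hne hy hyR hδ hc)⟩

end Gradient

variable [FiniteDimensional ℝ V] [MeasurableSpace V] [BorelSpace V]

/-- The cone measure of the level surface `{supportFun P = 1}`: the measure of a subset of the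
surface is the dimension times the volume of the cone over it with apex at the origin. -/
noncomputable def coneMeasure (P : Set V) : Measure V :=
  (finrank ℝ V : ℝ≥0∞) •
    (volume.restrict {z | supportFun P z ≤ 1}).map fun z => (supportFun P z)⁻¹ • z

/-- Surface measure, weighted by the distance from the origin to the tangent hyperplane of the
level surface `{supportFun P = 1}`, which is the inverse norm of the gradient. -/
noncomputable def weightedSurfaceMeasure (P : Set V) : Measure V :=
  (μHE[finrank ℝ V - 1] : Measure V).withDensity fun x =>
    ENNReal.ofReal ‖gradient (supportFun P) x‖⁻¹

lemma measurable_inv_supportFun_smul (hP : IsCompact P) (hne : P.Nonempty) :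
    Measurable fun z : V => (supportFun P z)⁻¹ • z :=
  (continuous_supportFun hP hne).measurable.inv.smul measurable_id

lemma coneMeasure_apply (hP : IsCompact P) (h0 : 0 ∈ P) {B : Set V} (hB : MeasurableSet B)
    (hBP : ∀ x ∈ B, supportFun P x = 1) :
    coneMeasure P B = finrank ℝ V * volume (Ioc (0 : ℝ) 1 • B) := by
  have hne : P.Nonempty := ⟨0, h0⟩
  have hproj := measurable_inv_supportFun_smul hP hne
  rw [coneMeasure, Measure.smul_apply, Measure.map_apply hproj hB, smul_eq_mul,
    Measure.restrict_apply (hproj hB)]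
  congr 2
  ext z
  rw [mem_Ioc_zero_one_smul_iff (fun x t ht => supportFun_smul hP hne ht.le x) hBP]
  have hpos : (supportFun P z)⁻¹ • z ∈ B → 0 < supportFun P z := fun hz => by
    refine (supportFun_nonneg hP h0 z).lt_of_ne' fun hzero => ?_
    have hone := hBP _ hz
    rw [hzero, inv_zero, zero_smul, supportFun_zero hP hne] at hone
    exact zero_ne_one hone
  exact ⟨fun hz => ⟨⟨hpos hz.1, hz.2⟩, hz.1⟩, fun hz => ⟨hz.2, hz.1.2⟩⟩

lemma coneMeasure_compl_smoothLevel (hP : IsCompact P) (h0 : 0 ∈ interior P) :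
    coneMeasure P (smoothLevel P)ᶜ = 0 := by
  have hne : P.Nonempty := ⟨0, interior_subset h0⟩
  have hproj := measurable_inv_supportFun_smul hP hne
  have hS := (measurableSet_smoothLevel hP hne).compl
  rcases subsingleton_or_nontrivial V with hV | hV
  · simp [coneMeasure, finrank_zero_of_subsingleton]
  rw [coneMeasure, Measure.smul_apply, Measure.map_apply hproj hS, smul_eq_mul,
    Measure.restrict_apply (hproj hS)]
  refine mul_eq_zero_of_right _ (measure_mono_null (fun z hz => ?_)
    (measure_union_null (measure_singleton (0 : V))
      (ae_iff.1 (ae_differentiableAt_supportFun hP hne))))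
  by_contra! hcon
  obtain ⟨hz0, hdiff⟩ := not_or.1 hcon
  have hpos := supportFun_pos hP h0 hz0
  refine hz.1 ⟨?_, ?_⟩
  · rw [supportFun_smul hP hne (inv_pos.2 hpos).le, inv_mul_cancel₀ hpos.ne']
  · exact (differentiableAt_supportFun_smul_iff hP hne (inv_pos.2 hpos)).2 (not_not.1 hdiff)

lemma exists_forall_withinFactor_coneMeasure (hP : IsCompact P) (h0 : 0 ∈ interior P) {c : ℝ≥0}
    (hc : 1 < c) : ∃ δ > 0, ∀ B ⊆ smoothLevel P, MeasurableSet B →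
      (∀ x ∈ B, ∀ y ∈ B, dist (gradient (supportFun P) x) (gradient (supportFun P) y) ≤ δ) →
      WithinFactor ((c : ℝ≥0∞) ^ (finrank ℝ V + (finrank ℝ V - 1) + 1)) (coneMeasure P B)
        (weightedSurfaceMeasure P B) := by
  have h0P := interior_subset h0
  have hne : P.Nonempty := ⟨0, h0P⟩
  obtain ⟨r, hr, hle⟩ := exists_mul_norm_le_supportFun hP h0
  have hbound : ∀ x ∈ smoothLevel P, ‖x‖ ≤ r⁻¹ := fun x hx => by
    rw [← one_div, le_div_iff₀' hr, ← hx.1]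
    exact hle x
  have hc0 : 0 < c := one_pos.trans hc
  have hcinv : (c : ℝ)⁻¹ < 1 := inv_lt_one_of_one_lt₀ (NNReal.one_lt_coe.2 hc)
  set η : ℝ := (1 - (c : ℝ)⁻¹) / 4
  have hη : 0 < η := by simp only [η]; linarith
  refine ⟨r * η / 2, by positivity, fun B hBP hB hδ => ?_⟩
  rcases B.eq_empty_or_nonempty with rfl | ⟨x₀, hx₀⟩
  · simp [WithinFactor]
  have hflat : NearlyFlat η (gradient (supportFun P) x₀) B :=
    nearlyFlat_of_dist_gradient_le hP hne hBP (fun x hx => hbound x (hBP hx))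
      (by field_simp; rfl) hδ hx₀
  have hcone := hflat.withinFactor_finrank_mul_volume_cone (c := c) hc0
    (by simp only [η]; linarith) (gradient_ne_zero_of_mem_smoothLevel hP hne (hBP hx₀)) hB
  have hratio : r⁻¹ * (r * η / 2) ≤ c - 1 := by
    rw [show r⁻¹ * (r * η / 2) = η / 2 by field_simp]
    simp only [η]
    linarith [two_sub_inv_le (NNReal.coe_pos.2 hc0)]
  have hdensity := withinFactor_setLIntegral_const (ν := μHE[finrank ℝ V - 1]) hB fun x hx =>
    withinFactor_inv_norm_gradient hP hne (hBP hx) (hBP hx₀) (hbound x (hBP hx))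
      (hbound x₀ (hBP hx₀)) (hδ x hx x₀ hx₀) hratio
  rw [coneMeasure_apply hP h0P hB fun x hx => (hBP hx).1, weightedSurfaceMeasure,
    withDensity_apply _ hB, pow_succ, pow_add]
  exact hcone.trans hdensity.symm

lemma weightedSurfaceMeasure_eq_coneMeasure (hP : IsCompact P) (h0 : 0 ∈ interior P) {B : Set V}
    (hBP : B ⊆ smoothLevel P) (hB : MeasurableSet B) :
    weightedSurfaceMeasure P B = coneMeasure P B := by
  refine (eq_of_forall_one_lt_withinFactor_pow
    (k := finrank ℝ V + (finrank ℝ V - 1) + 1) fun c hc => ?_).symm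
  obtain ⟨δ, hδ, hlocal⟩ := exists_forall_withinFactor_coneMeasure hP h0 hc
  exact withinFactor_measure_of_locally (measurable_gradient (supportFun P)) hδ hlocal hBP hB

lemma weightedSurfaceMeasure_restrict_smoothLevel (hP : IsCompact P) (h0 : 0 ∈ interior P) :
    (weightedSurfaceMeasure P).restrict (smoothLevel P) = coneMeasure P := by
  have hS := measurableSet_smoothLevel hP ⟨0, interior_subset h0⟩
  ext B hB
  rw [Measure.restrict_apply hB,
    weightedSurfaceMeasure_eq_coneMeasure hP h0 inter_subset_right (hB.inter hS),
    measure_inter_conull (coneMeasure_compl_smoothLevel hP h0)]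

lemma setLIntegral_smoothLevel [Nontrivial V] (hP : IsCompact P) (h0 : 0 ∈ interior P)
    {F : V → ℝ≥0∞} (hF : Measurable F) :
    ∫⁻ x in smoothLevel P, ENNReal.ofReal ‖gradient (supportFun P) x‖⁻¹ * F x
        ∂μHE[finrank ℝ V - 1] =
      ∫⁻ φ : sphere (0 : V) 1, F ((supportFun P φ)⁻¹ • φ) *
        ENNReal.ofReal ((supportFun P φ ^ finrank ℝ V)⁻¹) ∂(volume : Measure V).toSphere := by
  have hne : P.Nonempty := ⟨0, interior_subset h0⟩
  have hproj := measurable_inv_supportFun_smul hP hne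
  have hdensity : Measurable fun x => ENNReal.ofReal ‖gradient (supportFun P) x‖⁻¹ :=
    (measurable_gradient (supportFun P)).norm.inv.ennreal_ofReal
  have hradial : ∀ x, ∀ t : ℝ, 0 < t →
      F ((supportFun P (t • x))⁻¹ • t • x) = F ((supportFun P x)⁻¹ • x) := fun x t ht => by
    rw [supportFun_smul hP hne ht.le, smul_smul, mul_inv, mul_right_comm, inv_mul_cancel₀ ht.ne',
      one_mul]
  calc _ = ∫⁻ x, F x ∂(coneMeasure P) := by
        rw [← weightedSurfaceMeasure_restrict_smoothLevel hP h0, weightedSurfaceMeasure,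
          restrict_withDensity (measurableSet_smoothLevel hP hne),
          lintegral_withDensity_eq_lintegral_mul _ hdensity hF]
        rfl
    _ = finrank ℝ V * ∫⁻ z in {z | supportFun P z ≤ 1}, F ((supportFun P z)⁻¹ • z) := by
        rw [coneMeasure, lintegral_smul_measure, lintegral_map hF hproj, smul_eq_mul]
    _ = _ := finrank_mul_setLIntegral_of_homogeneous volume
        (continuous_supportFun hP hne).measurable
        (fun x t ht => supportFun_smul hP hne ht.le x) (fun x hx => supportFun_pos hP h0 hx)
        (hF.comp hproj) hradial

end ConeMeasure

/-! ### Duality of the Funk area -/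

section Area

variable {d : ℕ} {A G K : Set (E d)}

lemma two_mul_area_polarIn_inter_orthogonal_eq_lintegral_sphere (hd : 0 < d) (hA : IsCompact A)
    (hconv : Convex ℝ A) (h0 : 0 ∈ interior A) {n : E d} (hn : ‖n‖ = 1) :
    2 * μHE[d - 1] (polarIn (ℝ ∙ n)ᗮ (A ∩ (ℝ ∙ n)ᗮ)) =
      ∫⁻ θ : sphere (0 : E d) 1, ENNReal.ofReal |⟪gradient (supportFun A) θ, n⟫| *
        ENNReal.ofReal ((supportFun A θ ^ d)⁻¹) ∂(volume : Measure (E d)).toSphere := by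
  have hne : A.Nonempty := ⟨0, interior_subset h0⟩
  have hnontrivial : Nontrivial (E d) :=
    nontrivial_of_finrank_pos (R := ℝ) (by rwa [finrank_euclideanSpace_fin])
  have hpolar := finrank_mul_setLIntegral_of_homogeneous (volume : Measure (E d))
    (continuous_supportFun hA hne).measurable (fun x t ht => supportFun_smul hA hne ht.le x)
    (fun x hx => supportFun_pos hA h0 hx)
    (Q := fun x => ENNReal.ofReal |⟪gradient (supportFun A) x, n⟫|)
    ((measurable_gradient (supportFun A)).inner measurable_const).abs.ennreal_ofReal
    (fun x t ht => by rw [gradient_supportFun_smul hA hne ht])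
  rw [finrank_euclideanSpace_fin] at hpolar
  rw [two_mul_area_polarIn_inter_orthogonal hA hconv h0 hn, hpolar]

lemma two_mul_area_polarIn_funkBall (hd : 0 < d) (hG : IsConvexBody G) (hK : IsConvexBody K)
    (h0 : 0 ∈ interior G) (hGK : G ⊆ interior K) {x : E d} (hx : x ∈ smoothBoundary G) :
    2 * μHE[d - 1] (polarIn (tangentSpace G x) (funkBall K x ∩ tangentSpace G x)) =
      ENNReal.ofReal ‖gradient (supportFun (polarBody G)) x‖⁻¹ *
      ∫⁻ θ : sphere (0 : E d) 1,
        ENNReal.ofReal |⟪gradient (supportFun K) θ, gradient (supportFun (polarBody G)) x⟫ - 1| *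
        ENNReal.ofReal (((supportFun K θ - ⟪x, θ⟫) ^ d)⁻¹) ∂(volume : Measure (E d)).toSphere := by
  have hcompact := isCompact_polarBody hG.isCompact h0
  have hlevel : x ∈ smoothLevel (polarBody G) := smoothBoundary_eq_smoothLevel hG h0 ▸ hx
  have hxK : x ∈ interior K :=
    hGK ((mem_iff_supportFun_polarBody_le_one hG h0).2 hlevel.1.le)
  have hne : K.Nonempty := ⟨x, interior_subset hxK⟩
  have hinner := inner_gradient_of_mem_smoothLevel hcompact (nonempty_polarBody G) hlevel
  have hnormal := outerNormal_eq hG h0 hx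
  have hunit : ‖outerNormal G x‖ = 1 := hnormal ▸ norm_smul_inv_norm
    (gradient_ne_zero_of_mem_smoothLevel hcompact (nonempty_polarBody G) hlevel)
  have hKx := hK.image_sub_const x
  have hdiff := ae_toSphere_of_ae volume (measurableSet_of_differentiableAt ℝ (supportFun K))
    (fun y t ht => (differentiableAt_supportFun_smul_iff hK.isCompact hne ht).1)
    (ae_differentiableAt_supportFun hK.isCompact hne)
  rw [funkBall_eq hK hxK, tangentSpace,
    two_mul_area_polarIn_inter_orthogonal_eq_lintegral_sphere hd hKx.isCompact hKx.convex
      (zero_mem_interior_image_sub_const hxK) hunit,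
    ← lintegral_const_mul' _ _ ENNReal.ofReal_ne_top]
  refine lintegral_congr_ae ?_
  filter_upwards [hdiff] with θ hθ
  rw [gradient_supportFun_image_sub_const hK.isCompact hne x hθ,
    supportFun_image_sub_const hK.isCompact hne, hnormal, real_inner_smul_right, inner_sub_left,
    real_inner_comm _ x, hinner, abs_mul, abs_of_nonneg (by positivity),
    ENNReal.ofReal_mul (by positivity), mul_assoc]

/-- The kernel of the double integral over the sphere that expresses the Funk area of `∂G` in the
geometry of `K`, for `A = G°`. The ray through `φ` meets `∂G` in the point `φ / supportFun A φ`, and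
`θ` is the outer normal of `K` at the boundary point `gradient (supportFun K) θ`. -/
noncomputable def funkAreaKernel (A K : Set (E d)) (φ θ : E d) : ℝ≥0∞ :=
  ENNReal.ofReal |⟪gradient (supportFun K) θ, gradient (supportFun A) φ⟫ - 1| *
    ENNReal.ofReal (((supportFun A φ * supportFun K θ - ⟪φ, θ⟫) ^ d)⁻¹)

lemma funkAreaKernel_comm (A K : Set (E d)) (φ θ : E d) :
    funkAreaKernel A K φ θ = funkAreaKernel K A θ φ := by
  rw [funkAreaKernel, funkAreaKernel, real_inner_comm, real_inner_comm φ,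
    mul_comm (supportFun K θ)]

lemma measurable_funkAreaKernel (hA : IsCompact A) (hneA : A.Nonempty) (hK : IsCompact K)
    (hneK : K.Nonempty) : Measurable fun q : E d × E d => funkAreaKernel A K q.1 q.2 := by
  have hgradient : Measurable fun q : E d × E d =>
      ⟪gradient (supportFun K) q.2, gradient (supportFun A) q.1⟫ :=
    ((measurable_gradient _).comp measurable_snd).inner
      ((measurable_gradient _).comp measurable_fst)
  have : Measurable fun q : E d × E d => ⟪q.1, q.2⟫ := by fun_prop
  have hmeasA := (continuous_supportFun hA hneA).measurable
  have hmeasK := (continuous_supportFun hK hneK).measurable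
  exact (hgradient.sub_const 1).abs.ennreal_ofReal.mul (by fun_prop)

lemma funkAreaKernel_inv_smul (hA : IsCompact A) (hne : A.Nonempty) {φ : E d}
    (hφ : 0 < supportFun A φ) (θ : E d) :
    funkAreaKernel A K ((supportFun A φ)⁻¹ • φ) θ *
      ENNReal.ofReal ((supportFun A φ ^ d)⁻¹) = funkAreaKernel A K φ θ := by
  simp only [funkAreaKernel]
  rw [gradient_supportFun_smul hA hne (inv_pos.2 hφ), supportFun_smul hA hne (inv_pos.2 hφ).le,
    inv_mul_cancel₀ hφ.ne', one_mul, mul_assoc, mul_comm (ENNReal.ofReal _⁻¹),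
    ← ENNReal.ofReal_mul (by positivity), ← mul_inv, ← mul_pow, mul_sub, real_inner_smul_left,
    mul_inv_cancel_left₀ hφ.ne']

lemma two_mul_setLIntegral_area_eq (hd : 0 < d) (hG : IsConvexBody G) (hK : IsConvexBody K)
    (h0 : 0 ∈ interior G) (hGK : G ⊆ interior K) :
    ∫⁻ x in smoothBoundary G,
      2 * μHE[d - 1] (polarIn (tangentSpace G x) (funkBall K x ∩ tangentSpace G x)) ∂μHE[d - 1] =
      ∫⁻ φ : sphere (0 : E d) 1, ∫⁻ θ : sphere (0 : E d) 1, funkAreaKernel (polarBody G) K φ θ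
        ∂(volume : Measure (E d)).toSphere ∂(volume : Measure (E d)).toSphere := by
  have hcompact := isCompact_polarBody hG.isCompact h0
  have hne := nonempty_polarBody G
  have h0P := zero_mem_interior_polarBody hG.isCompact ⟨0, interior_subset h0⟩
  have hneK : K.Nonempty := ⟨0, interior_subset (hGK (interior_subset h0))⟩
  have hnontrivial : Nontrivial (E d) :=
    nontrivial_of_finrank_pos (R := ℝ) (by rwa [finrank_euclideanSpace_fin])
  have hmeas : Measurable fun x => ∫⁻ θ : sphere (0 : E d) 1,
      funkAreaKernel (polarBody G) K x θ ∂(volume : Measure (E d)).toSphere :=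
    ((measurable_funkAreaKernel hcompact hne hK.isCompact hneK).comp
      (measurable_fst.prodMk (measurable_subtype_coe.comp measurable_snd))).lintegral_prod_right'
  have hcone := setLIntegral_smoothLevel hcompact h0P hmeas
  rw [finrank_euclideanSpace_fin] at hcone
  calc _ = _ := ?_
    _ = _ := hcone
    _ = _ := lintegral_congr fun φ => by
      rw [← lintegral_mul_const' _ _ ENNReal.ofReal_ne_top]
      exact lintegral_congr fun θ => funkAreaKernel_inv_smul hcompact hne
        (supportFun_pos hcompact h0P (ne_zero_of_mem_unit_sphere φ)) _
  rw [← smoothBoundary_eq_smoothLevel hG h0]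
  refine setLIntegral_congr_fun (smoothBoundary_eq_smoothLevel hG h0 ▸
    measurableSet_smoothLevel hcompact hne) fun x hx => ?_
  have hlevel : supportFun (polarBody G) x = 1 := (smoothBoundary_eq_smoothLevel hG h0 ▸ hx :).1
  simp only [two_mul_area_polarIn_funkBall hd hG hK h0 hGK hx, funkAreaKernel, hlevel, one_mul]

lemma funkArea_eq_lintegral_sphere (hd : 0 < d) (hG : IsConvexBody G) (hK : IsConvexBody K)
    (h0 : 0 ∈ interior G) (hGK : G ⊆ interior K) :
    funkArea K G = (∫⁻ φ : sphere (0 : E d) 1, ∫⁻ θ : sphere (0 : E d) 1,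
      funkAreaKernel (polarBody G) K φ θ ∂(volume : Measure (E d)).toSphere
        ∂(volume : Measure (E d)).toSphere) / (2 * unitBallVolume (d - 1)) := by
  have hball : (unitBallVolume (d - 1))⁻¹ ≠ ∞ :=
    ENNReal.inv_ne_top.2 (measure_closedBall_pos _ _ one_pos).ne'
  rw [← two_mul_setLIntegral_area_eq hd hG hK h0 hGK, lintegral_const_mul' _ _ ENNReal.ofNat_ne_top,
    ENNReal.mul_div_mul_left _ _ two_ne_zero ENNReal.ofNat_ne_top, funkArea,
    ENNReal.div_eq_inv_mul, ← lintegral_const_mul' _ _ hball]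
  simp only [areaDensity, ENNReal.div_eq_inv_mul]

theorem funkArea_polarBody_polarBody (hd : 0 < d) (hG : IsConvexBody G) (hK : IsConvexBody K)
    (h0 : 0 ∈ interior G) (hGK : G ⊆ interior K) :
    funkArea (polarBody G) (polarBody K) = funkArea K G := by
  have h0K : 0 ∈ interior K := hGK (interior_subset h0)
  have hmeas := measurable_funkAreaKernel hK.isCompact ⟨0, interior_subset h0K⟩
    (isCompact_polarBody hG.isCompact h0) (nonempty_polarBody G)
  rw [funkArea_eq_lintegral_sphere hd hG hK h0 hGK,
    funkArea_eq_lintegral_sphere hd (hK.polarBody h0K) (hG.polarBody h0)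
      (zero_mem_interior_polarBody hK.isCompact ⟨0, interior_subset h0K⟩)
      (polarBody_subset_interior_polarBody hG.isCompact (interior_subset h0) hK h0K hGK),
    hK.polarBody_polarBody h0K, lintegral_lintegral_swap]
  · simp only [funkAreaKernel_comm K]
  · exact (hmeas.comp (measurable_subtype_coe.prodMap measurable_subtype_coe)).aemeasurable

end Area

end HolmesThompson

theorem mainTheorem3 (d : ℕ) (hd : 2 ≤ d) (G K : Set (HolmesThompson.E d))
    (hG : HolmesThompson.IsConvexBody G) (hK : HolmesThompson.IsConvexBody K)
    (hOG : (0 : HolmesThompson.E d) ∈ interior G) (hGK : G ⊆ interior K) :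
    HolmesThompson.funkVolume K G =
        HolmesThompson.funkVolume (HolmesThompson.polarBody G) (HolmesThompson.polarBody K) ∧
      HolmesThompson.funkArea K G =
        HolmesThompson.funkArea (HolmesThompson.polarBody G) (HolmesThompson.polarBody K) :=
  ⟨(HolmesThompson.funkVolume_polarBody_polarBody hG hK hOG hGK).symm,
    (HolmesThompson.funkArea_polarBody_polarBody (by lia) hG hK hOG hGK).symm⟩
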